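/- Let $n\ge 2$. Let $S_1,\dots,S_n$ be the left creation operators on the Fock space $\ell^2(\mathbb F_n^+)$ of the free semigroup on $n$ letters, let $\mathfrak A_n$ be the norm-closed unital algebra that they generate (the noncommutative disc algebra), and let $\phi$ be an isometric algebra automorphism of $\mathfrak A_n$. Let $\mathfrak A_n\times_\phi\mathbb Z^+$ be the semicrossed product: the universal operator algebra generated by $\mathfrak A_n$ and a contraction $U$ with $AU=U\phi(A)$ for all $A\in\mathfrak A_n$; that is, the completion of the polynomials in $U$ and the elements of $\mathfrak A_n$ in the seminorm $\sup\|(\pi\times K)(p)\|$, taken over all completely contractive unital representations $\pi$ of $\mathfrak A_n$ on Hilbert spaces and contractions $K$ with $\pi(A)K=K\pi(\phi(A))$ for all $A$. Write $\mathbb B_n$ for the open unit ball of $\mathbb C^n$, $\mathbb D$ for the open unit disc and $\mathbb T$ for the unit circle. Let $\operatorname{Fix}(\phi)\subset\mathbb C^n$ be the set of the points $(\theta(S_1),\dots,\theta(S_n))$ for the characters $\theta$ of $\mathfrak A_n$ with $\theta\circ\phi=\theta$. Put $F_0(\phi)=\operatorname{Fix}(\phi)\cap\mathbb B_n$ and $F_1(\phi)=\operatorname{Fix}(\phi)\cap\partial\mathbb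 B_n$. A set $O$ of characters of a Banach algebra $\mathcal A$ is called analytic if there are an integer $k\ge 1$, a domain (non-empty connected open set) $\Omega\subset\mathbb C^k$ and a homeomorphism $h$ of $\Omega$ onto $O$ (with the weak* topology) such that $w\mapsto h(w)(a)$ is analytic on $\Omega$ for every $a\in\mathcal A$. It is a maximal analytic set if it is contained in no other analytic set. (1) The map $\theta\mapsto\big((\theta(S_1),\dots,\theta(S_n)),\theta(U)\big)$ is a homeomorphism of the character space of $\mathfrak A_n\times_\phi\mathbb Z^+$ onto $$(\overline{\mathbb B}_n\times\{0\})\cup(\operatorname{Fix}(\phi)\times\overline{\mathbb D})\subset\mathbb C^n\times\mathbb C.$$ (2) Under this identification, the maximal analytic sets in the character space are exactly the following: - $\mathbb B_n\times\{0\}$, if $\phi\ne\mathrm{id}$; - $F_0(\phi)\times\mathbb D$, if $F_0(\phi)\ne\varnothing$; - $F_0(\phi)\times\{\lambda\}$ for each $\lambda\in\mathbb T$, if $F_0(\phi)$ has more than one point; - $\{x\}\times\mathbb D$ for each $x\in F_1(\phi)$. -/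

import Mathlib

open scoped ENNReal

noncomputable section

namespace NCSemicrossed

/-! ### The noncommutative disc algebra -/

/-- Fock space: square summable functions on the free semigroup on `n` letters. -/
abbrev Fock (n : ℕ) : Type := lp (fun _ : FreeMonoid (Fin n) => ℂ) 2

/-- Prefixing a word with the letter `i`. -/
def prefixLetter {n : ℕ} (i : Fin n) (w : FreeMonoid (Fin n)) : FreeMonoid (Fin n) :=
  FreeMonoid.of i * w

theorem prefixLetter_injective {n : ℕ} (i : Fin n) :
    Function.Injective (prefixLetter i) :=
  fun _ _ h => mul_left_cancel h

theorem hasSum_extend_sq {n : ℕ} (i : Fin n) (f : Fock n) :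
    HasSum (fun w => ‖Function.extend (prefixLetter i) (f : FreeMonoid (Fin n) → ℂ) 0 w‖ ^ (2 : ℝ))
      (‖f‖ ^ (2 : ℝ)) := by
  have h := lp.hasSum_norm (p := 2) (by norm_num) f
  have h2 := (hasSum_extend_zero (prefixLetter_injective i)).2 h
  simp only [ENNReal.toReal_ofNat] at h2
  convert h2 using 1
  funext w
  by_cases hw : ∃ v, prefixLetter i v = w
  · obtain ⟨v, rfl⟩ := hw
    simp [(prefixLetter_injective i).extend_apply]
  · simp [Function.extend_apply' _ _ _ hw]

/-- The left creation operator `S i`: it sends the basis vector at a word `w` to the basis vector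
at the word `i w`. That is, `(S i f) (i w) = f w`, and `S i f` vanishes at the words that do not
begin with `i`. -/
def creationIsometry (n : ℕ) (i : Fin n) : Fock n →ₗᵢ[ℂ] Fock n where
  toFun f := ⟨Function.extend (prefixLetter i) (f : FreeMonoid (Fin n) → ℂ) 0,
    memℓp_gen (by simpa using (hasSum_extend_sq i f).summable)⟩
  map_add' f g := by
    ext w
    change Function.extend (prefixLetter i) (fun v => f v + g v) 0 w =
      Function.extend (prefixLetter i) f 0 w + Function.extend (prefixLetter i) g 0 w
    by_cases hw : ∃ v, prefixLetter i v = w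
    · obtain ⟨v, rfl⟩ := hw
      simp only [(prefixLetter_injective i).extend_apply]
    · simp [Function.extend_apply' _ _ _ hw]
  map_smul' c f := by
    ext w
    by_cases hw : ∃ v, prefixLetter i v = w
    · obtain ⟨v, rfl⟩ := hw
      simp [(prefixLetter_injective i).extend_apply]
    · simp [Function.extend_apply' _ _ _ hw]
  norm_map' f := by
    have h := lp.hasSum_norm (p := 2) (by norm_num)
      (⟨Function.extend (prefixLetter i) (f : FreeMonoid (Fin n) → ℂ) 0,
        memℓp_gen (by simpa using (hasSum_extend_sq i f).summable)⟩ : Fock n)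
    simp only [ENNReal.toReal_ofNat] at h
    have h2 := h.unique (hasSum_extend_sq i f)
    exact (Real.rpow_left_inj (norm_nonneg _) (norm_nonneg _) (by norm_num)).1 h2

/-- The noncommutative disc algebra: the norm closed unital algebra generated by the left creation
operators on Fock space. -/
def discAlgebra (n : ℕ) : Subalgebra ℂ (Fock n →L[ℂ] Fock n) :=
  (Algebra.adjoin ℂ
    (Set.range fun i : Fin n => (creationIsometry n i).toContinuousLinearMap)).topologicalClosure

/-- The generator `S i` as an element of the noncommutative disc algebra. -/
def discGen (n : ℕ) (i : Fin n) : discAlgebra n :=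
  ⟨(creationIsometry n i).toContinuousLinearMap,
    Subalgebra.le_topologicalClosure _ (Algebra.subset_adjoin ⟨i, rfl⟩)⟩

/-! ### Completely contractive representations -/

/-- The operator on the Hilbert space sum of `k` copies of `H` given by a `k × k` matrix of
operators on `H`. -/
def matrixOperator {H : Type*} [NormedAddCommGroup H] [InnerProductSpace ℂ H] {k : ℕ}
    (M : Matrix (Fin k) (Fin k) (H →L[ℂ] H)) :
    PiLp 2 (fun _ : Fin k => H) →L[ℂ] PiLp 2 (fun _ : Fin k => H) :=
  (PiLp.continuousLinearEquiv 2 ℂ (fun _ : Fin k => H)).symm.toContinuousLinearMap ∘L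
    ContinuousLinearMap.pi fun i => ∑ j, M i j ∘L PiLp.proj 2 (fun _ : Fin k => H) j

/-- A unital representation of the noncommutative disc algebra is completely contractive if all
its entrywise extensions to square matrices are contractive. -/
def IsCompletelyContractive {n : ℕ} {H : Type*} [NormedAddCommGroup H] [InnerProductSpace ℂ H]
    (π : discAlgebra n →ₐ[ℂ] (H →L[ℂ] H)) : Prop :=
  ∀ (k : ℕ) (M : Matrix (Fin k) (Fin k) (discAlgebra n)),
    ‖matrixOperator (M.map π)‖ ≤ ‖matrixOperator (M.map (discAlgebra n).val)‖

/-! ### The semicrossed product -/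

/-- A covariant representation of an automorphism `φ` of the noncommutative disc algebra on a
Hilbert space `H`: a completely contractive representation `π` and a contraction `K` such that
`π(A) K = K π(φ(A))`. -/
structure CovariantRep {n : ℕ} (φ : discAlgebra n ≃ₐ[ℂ] discAlgebra n) where
  H : Type
  [normedAddCommGroup : NormedAddCommGroup H]
  [innerProductSpace : InnerProductSpace ℂ H]
  [completeSpace : CompleteSpace H]
  π : discAlgebra n →ₐ[ℂ] (H →L[ℂ] H)
  K : H →L[ℂ] H
  completelyContractive : IsCompletelyContractive π
  norm_le_one : ‖K‖ ≤ 1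
  covariant : ∀ a, π a * K = K * π (φ a)

attribute [instance] CovariantRep.normedAddCommGroup CovariantRep.innerProductSpace
  CovariantRep.completeSpace

/-- The generators of the semicrossed product: the elements of the noncommutative disc algebra,
and the contraction `U`. -/
inductive Gen (n : ℕ) : Type
  | coeff (a : discAlgebra n) : Gen n
  | shift : Gen n

/-- Noncommutative polynomials in the generators. The automorphism enters through the seminorm
that is put on them below. -/
def Poly {n : ℕ} (_φ : discAlgebra n ≃ₐ[ℂ] discAlgebra n) : Type := FreeAlgebra ℂ (Gen n)

section Poly

variable {n : ℕ} (φ : discAlgebra n ≃ₐ[ℂ] discAlgebra n)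

instance : Ring (Poly φ) := inferInstanceAs (Ring (FreeAlgebra ℂ (Gen n)))

instance : Algebra ℂ (Poly φ) := inferInstanceAs (Algebra ℂ (FreeAlgebra ℂ (Gen n)))

variable {φ}

/-- A generator as a polynomial. -/
def Poly.gen (φ : discAlgebra n ≃ₐ[ℂ] discAlgebra n) (g : Gen n) : Poly φ := FreeAlgebra.ι ℂ g

/-- The representation `π × K` of the polynomials that is given by a covariant representation. -/
def CovariantRep.eval (ρ : CovariantRep φ) : Poly φ →ₐ[ℂ] (ρ.H →L[ℂ] ρ.H) :=
  FreeAlgebra.lift ℂ fun g => Gen.casesOn g (fun a => ρ.π a) ρ.K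

theorem CovariantRep.eval_coeff (ρ : CovariantRep φ) (a : discAlgebra n) :
    ρ.eval (Poly.gen φ (Gen.coeff a)) = ρ.π a :=
  FreeAlgebra.lift_ι_apply _ _

theorem CovariantRep.eval_shift (ρ : CovariantRep φ) : ρ.eval (Poly.gen φ Gen.shift) = ρ.K :=
  FreeAlgebra.lift_ι_apply _ _

theorem norm_matrixOperator_one {E : Type*} [NormedAddCommGroup E] [InnerProductSpace ℂ E]
    (T : E →L[ℂ] E) : ‖matrixOperator (Matrix.of fun _ _ : Fin 1 => T)‖ = ‖T‖ := by
  have key (x : PiLp 2 (fun _ : Fin 1 => E)) :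
      ‖matrixOperator (Matrix.of fun _ _ : Fin 1 => T) x‖ = ‖T (x 0)‖ := by
    simp [PiLp.norm_eq_of_L2, matrixOperator]
  have key' (x : PiLp 2 (fun _ : Fin 1 => E)) : ‖x‖ = ‖x 0‖ := by
    simp [PiLp.norm_eq_of_L2]
  refine le_antisymm ?_ ?_
  · refine ContinuousLinearMap.opNorm_le_bound _ (norm_nonneg _) fun x => ?_
    rw [key, key']
    exact T.le_opNorm (x 0)
  · refine ContinuousLinearMap.opNorm_le_bound _ (ContinuousLinearMap.opNorm_nonneg _) fun x => ?_
    have h := (matrixOperator (Matrix.of fun _ _ : Fin 1 => T)).le_opNorm (WithLp.toLp 2 fun _ => x)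
    rwa [key, key'] at h

theorem IsCompletelyContractive.norm_le {H : Type*} [NormedAddCommGroup H] [InnerProductSpace ℂ H]
    {π : discAlgebra n →ₐ[ℂ] (H →L[ℂ] H)} (hπ : IsCompletelyContractive π) (a : discAlgebra n) :
    ‖π a‖ ≤ ‖a‖ := by
  have h := hπ 1 (Matrix.of fun _ _ => a)
  have h1 := norm_matrixOperator_one (π a)
  have h2 := norm_matrixOperator_one (a : Fock n →L[ℂ] Fock n)
  exact h1.symm.trans_le (h.trans h2.le)

theorem eval_bounded (p : Poly φ) : ∃ C : ℝ, ∀ ρ : CovariantRep φ, ‖ρ.eval p‖ ≤ C := by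
  induction p using FreeAlgebra.induction with
  | grade0 c =>
    refine ⟨‖c‖, fun ρ => ?_⟩
    refine (congrArg norm (ρ.eval.commutes c)).trans_le ?_
    rw [Algebra.algebraMap_eq_smul_one]
    refine (norm_smul_le _ _).trans ?_
    exact mul_le_of_le_one_right (norm_nonneg _) ContinuousLinearMap.norm_id_le
  | grade1 g =>
    cases g with
    | coeff a =>
      refine ⟨‖a‖, fun ρ => ?_⟩
      exact (congrArg norm (ρ.eval_coeff a)).trans_le (ρ.completelyContractive.norm_le a)
    | shift =>
      refine ⟨1, fun ρ => ?_⟩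
      exact (congrArg norm ρ.eval_shift).trans_le ρ.norm_le_one
  | mul p q hp hq =>
    obtain ⟨C, hC⟩ := hp
    obtain ⟨D, hD⟩ := hq
    refine ⟨C * D, fun ρ => ?_⟩
    refine (congrArg norm (map_mul ρ.eval p q)).trans_le ((norm_mul_le _ _).trans ?_)
    exact mul_le_mul (hC ρ) (hD ρ) (norm_nonneg _) ((norm_nonneg _).trans (hC ρ))
  | add p q hp hq =>
    obtain ⟨C, hC⟩ := hp
    obtain ⟨D, hD⟩ := hq
    refine ⟨C + D, fun ρ => ?_⟩
    refine (congrArg norm (map_add ρ.eval p q)).trans_le ((norm_add_le _ _).trans ?_)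
    exact add_le_add (hC ρ) (hD ρ)

/-- The universal seminorm: the supremum of `‖(π × K)(p)‖` over all covariant representations.
Hilbert spaces in `Type` suffice for this: the noncommutative disc algebra is separable, so that
a norm `‖(π × K)(p)‖` is the supremum of the norms that the restrictions of `π` and `K` to
separable invariant subspaces give. -/
def universalNorm (p : Poly φ) : ℝ := ⨆ ρ : CovariantRep φ, ‖ρ.eval p‖

theorem norm_eval_le (ρ : CovariantRep φ) (p : Poly φ) : ‖ρ.eval p‖ ≤ universalNorm p := by
  obtain ⟨C, hC⟩ := eval_bounded p
  exact le_ciSup (f := fun ρ : CovariantRep φ => ‖ρ.eval p‖) ⟨C, by rintro _ ⟨ρ, rfl⟩; exact hC ρ⟩ ρ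

theorem universalNorm_nonneg (p : Poly φ) : 0 ≤ universalNorm p :=
  Real.iSup_nonneg fun _ => norm_nonneg _

/-- The universal seminorm as a submultiplicative seminorm. -/
def universalSeminorm (φ : discAlgebra n ≃ₐ[ℂ] discAlgebra n) : RingSeminorm (Poly φ) where
  toFun := universalNorm
  map_zero' := by simp [universalNorm]
  add_le' p q := Real.iSup_le
    (fun ρ => by
      rw [map_add]
      exact (norm_add_le _ _).trans (add_le_add (norm_eval_le ρ p) (norm_eval_le ρ q)))
    (add_nonneg (universalNorm_nonneg p) (universalNorm_nonneg q))
  neg' p := by simp [universalNorm]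
  mul_le' p q := Real.iSup_le
    (fun ρ => by
      rw [map_mul]
      exact (norm_mul_le _ _).trans
        (mul_le_mul (norm_eval_le ρ p) (norm_eval_le ρ q) (norm_nonneg _) (universalNorm_nonneg p)))
    (mul_nonneg (universalNorm_nonneg p) (universalNorm_nonneg q))

instance : SeminormedRing (Poly φ) := (universalSeminorm φ).toSeminormedRing

instance : NormedAlgebra ℂ (Poly φ) where
  norm_smul_le c p := Real.iSup_le
    (fun ρ => by
      rw [map_smul, norm_smul]
      exact mul_le_mul_of_nonneg_left (norm_eval_le ρ p) (norm_nonneg c))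
    (mul_nonneg (norm_nonneg c) (universalNorm_nonneg p))

end Poly

/-- The semicrossed product of the noncommutative disc algebra by `φ`: the universal operator
algebra generated by the noncommutative disc algebra and a contraction `U` with `A U = U φ(A)`.
It is the Hausdorff completion of the polynomials in the universal seminorm; polynomials that
vanish in all covariant representations, such as `A U - U φ(A)`, become zero there. -/
abbrev SemicrossedProduct {n : ℕ} (φ : discAlgebra n ≃ₐ[ℂ] discAlgebra n) : Type :=
  UniformSpace.Completion (Poly φ)

section SemicrossedProduct

variable {n : ℕ} (φ : discAlgebra n ≃ₐ[ℂ] discAlgebra n)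

/-- The canonical map of the polynomials onto a dense subalgebra of the semicrossed product. -/
def Poly.toCompletion : Poly φ →+* SemicrossedProduct φ := UniformSpace.Completion.coeRingHom

/-- The element of the semicrossed product given by `a` in the noncommutative disc algebra. -/
def coeff (a : discAlgebra n) : SemicrossedProduct φ :=
  Poly.toCompletion φ (Poly.gen φ (Gen.coeff a))

/-- The universal contraction `U` in the semicrossed product. -/
def shift : SemicrossedProduct φ :=
  Poly.toCompletion φ (Poly.gen φ Gen.shift)

/-- The coordinates of a character `θ` of the semicrossed product: the point
`(θ(S 1), …, θ(S n))` and the scalar `θ(U)`. -/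
def coords (θ : WeakDual.characterSpace ℂ (SemicrossedProduct φ)) :
    EuclideanSpace ℂ (Fin n) × ℂ :=
  (WithLp.toLp 2 fun i => θ (coeff φ (discGen n i)), θ (shift φ))

/-- `Fix(φ)`: the characters `θ` of the noncommutative disc algebra with `θ ∘ φ = θ`, each
identified with the point `(θ(S 1), …, θ(S n))`. -/
def fixSet : Set (EuclideanSpace ℂ (Fin n)) :=
  {z | ∃ θ : WeakDual.characterSpace ℂ (discAlgebra n),
    (∀ i, θ (discGen n i) = z i) ∧ ∀ a, θ (φ a) = θ a}

/-- The fixed points in the open ball. -/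
def fixInterior : Set (EuclideanSpace ℂ (Fin n)) := fixSet φ ∩ Metric.ball 0 1

/-- The fixed points on the boundary of the ball. -/
def fixBoundary : Set (EuclideanSpace ℂ (Fin n)) := fixSet φ ∩ Metric.sphere 0 1

end SemicrossedProduct

/-! ### Analytic sets -/

/-- A set `O` of characters of a Banach algebra `A` is analytic if it is the image of a domain in
`ℂ ^ k`, for some `k ≥ 1`, under a homeomorphism `h` onto `O` (in the weak* topology) such that
`w ↦ h w a` is analytic for every `a` in `A`. On an open set, analytic is the same as complex
differentiable. -/
def IsAnalyticSet {A : Type*} [NormedRing A] [NormedSpace ℂ A]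
    (O : Set (WeakDual.characterSpace ℂ A)) : Prop :=
  ∃ (k : ℕ) (Ω : Set (EuclideanSpace ℂ (Fin k)))
    (h : EuclideanSpace ℂ (Fin k) → WeakDual.characterSpace ℂ A),
    1 ≤ k ∧ IsOpen Ω ∧ IsConnected Ω ∧ Topology.IsEmbedding (Ω.domRestrict h) ∧ h '' Ω = O ∧
      ∀ a : A, DifferentiableOn ℂ (fun w => h w a) Ω

/-- A maximal analytic set: one that is contained in no other analytic set. -/
def IsMaximalAnalyticSet {A : Type*} [NormedRing A] [NormedSpace ℂ A]
    (O : Set (WeakDual.characterSpace ℂ A)) : Prop :=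
  Maximal IsAnalyticSet O

end NCSemicrossed

end

/-!
The characters of the noncommutative disc algebra are the points of the closed unit ball: at a point
`z` of the open ball the character is the vector functional of a joint eigenvector of the adjoints of
the creation operators (`exists_character_of_norm_lt_one`), the sphere follows by compactness, and
`‖∑ a i • S i‖ = ‖a‖` excludes all other points. A character of the semicrossed product is such a
point together with the value `μ` of `U`; if `μ ≠ 0`, the covariance relation makes the point fixed
by `φ`. Conversely, the admissible pairs give one-dimensional covariant representations, because
characters are completely contractive (`isCompletelyContractive_scalarRep`). All character spaces in
question are compact, so that continuous injective coordinates are embeddings.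

An analytic set is parametrized by holomorphic coordinates `(Z, μ)` with values in the closed unit
balls. By the maximum principle each of `Z` and `μ` is a constant of norm one or lies in the open
ball. If `μ` is not identically zero, then `μ (θ(φ(A)) - θ(A)) = 0` and the identity theorem show
that all points `Z` are fixed. Hence each analytic set lies in one of the listed sets
(`IsAnalyticSet.exists_isListed`).

That the listed sets are analytic needs a description of the fixed points in the open ball: they
form an affine subspace (`exists_submodule_fixedPoints`). The map that `φ` induces is a holomorphic
self-map of the ball, continuous up to the boundary. If it fixes two points, composing it on the
complex line through them with a left inverse of that disc gives a self-map of the unit disc with two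
fixed points, the identity by the Schwarz-Pick lemma. The equality on the unit circle forces the map
to be the identity on the boundary of the disc, hence on all of the disc (`fixed_on_line`).

That no listed set contains another one is immediate except for `𝔹 × {0} ⊆ F₀ × 𝔻`. In that case `φ`
fixes all characters of the open ball, so that the Fourier coefficient of the contraction `φ (S i)`
at the letter `i` is one. This leaves room for no other coefficient, and `φ (S i) = S i`
(`eq_discGen_of_forall_character`).
-/

noncomputable section

open scoped ENNReal ComplexConjugate Topology
open Metric Set Filter Complex

namespace NCSemicrossed

/-! ### Holomorphic functions on open subsets of complex normed spaces -/

/-- Uniform limits of holomorphic functions on an open subset of a complex normed space are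
holomorphic. -/
theorem differentiableOn_of_uniform_approx {E : Type*} [NormedAddCommGroup E] [NormedSpace ℂ E]
    {U : Set E} (hU : IsOpen U) {f : E → ℂ}
    (h : ∀ ε > 0, ∃ g : E → ℂ, DifferentiableOn ℂ g U ∧ ∀ x ∈ U, ‖f x - g x‖ ≤ ε) :
    DifferentiableOn ℂ f U := by
  have h' (m : ℕ) : ∃ g : E → ℂ, DifferentiableOn ℂ g U ∧
      ∀ x ∈ U, ‖f x - g x‖ ≤ 1 / ((m : ℝ) + 1) :=
    h _ (by positivity)
  choose g hg hfg using h'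
  have hlim : Tendsto (fun m : ℕ => 1 / ((m : ℝ) + 1)) atTop (𝓝 0) :=
    tendsto_one_div_add_atTop_nhds_zero_nat
  intro x hx
  obtain ⟨R, hR, hRU⟩ := Metric.isOpen_iff.1 hU x hx
  set r := R / 2 with hr
  have hr0 : 0 < r := by positivity
  have hsub (y) (hy : y ∈ ball x r) : ball y r ⊆ U := fun z hz => hRU <| by
    have h1 := dist_triangle z y x
    rw [mem_ball] at *
    linarith
  have hpt (y) (hy : y ∈ U) : Tendsto (fun m => g m y) atTop (𝓝 (f y)) := by
    rw [tendsto_iff_norm_sub_tendsto_zero]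
    refine squeeze_zero (fun _ => norm_nonneg _) (fun m => ?_) hlim
    rw [norm_sub_rev]
    exact hfg m y hy
  -- The Schwarz lemma on the ball of radius `r` around `y` bounds the derivative of `g k - g m`.
  have hcau : UniformCauchySeqOn (fun m => fderiv ℂ (g m)) atTop (ball x r) := by
    rw [Metric.uniformCauchySeqOn_iff]
    intro ε hε
    have h0 : ∀ᶠ m : ℕ in atTop, 1 / ((m : ℝ) + 1) < ε * r / 5 :=
      (tendsto_order.1 hlim).2 _ (by positivity)
    obtain ⟨N, hN⟩ := eventually_atTop.1 h0
    refine ⟨N, fun k hk m hm y hy => ?_⟩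
    have hkm (z) (hz : z ∈ U) : ‖g k z - g m z‖ ≤ 2 * (ε * r / 5) := by
      have e1 := hfg k z hz
      have e2 := hfg m z hz
      have e3 := norm_sub_le (f z - g m z) (f z - g k z)
      have e4 : f z - g m z - (f z - g k z) = g k z - g m z := by ring
      rw [e4] at e3
      linarith [hN k hk, hN m hm]
    have hyU : y ∈ U := hsub y hy (mem_ball_self hr0)
    have hd : DifferentiableOn ℂ (fun z => g k z - g m z) (ball y r) :=
      ((hg k).sub (hg m)).mono (hsub y hy)
    have hmaps : MapsTo (fun z => g k z - g m z) (ball y r)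
        (closedBall (g k y - g m y) (4 * (ε * r / 5))) := fun z hz => by
      rw [mem_closedBall, dist_eq_norm]
      exact (norm_sub_le _ _).trans (by linarith [hkm z (hsub y hy hz), hkm y hyU])
    have hb := Complex.norm_fderiv_le_div_of_mapsTo_ball hd hmaps hr0
    rw [fderiv_fun_sub ((hg k).differentiableAt (hU.mem_nhds hyU))
      ((hg m).differentiableAt (hU.mem_nhds hyU))] at hb
    rw [dist_eq_norm]
    refine hb.trans_lt ?_
    rw [div_lt_iff₀ hr0]
    nlinarith
  have hlimit (y) (hy : y ∈ ball x r) : ∃ L, Tendsto (fun m => fderiv ℂ (g m) y) atTop (𝓝 L) :=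
    cauchySeq_tendsto_of_complete (hcau.cauchySeq hy)
  choose! g' hg' using hlimit
  have hunif := hcau.tendstoUniformlyOn_of_tendsto hg'
  have hballU : ball x r ⊆ U := hsub x (mem_ball_self hr0)
  exact (hasFDerivAt_of_tendsto_locally_uniformly_on' isOpen_ball
    hunif.tendstoLocallyUniformlyOn (fun m => (hg m).mono hballU)
    (fun y hy => hpt y (hballU hy)) (mem_ball_self hr0)).differentiableAt.differentiableWithinAt

/-- The identity theorem. -/
theorem eqOn_zero_of_eventuallyEq_zero {E : Type*} [NormedAddCommGroup E] [NormedSpace ℂ E]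
    {U : Set E} (hU : IsOpen U) (hc : IsPreconnected U) {f : E → ℂ} (hf : DifferentiableOn ℂ f U)
    {x₀ : E} (hx₀ : x₀ ∈ U) (h0 : f =ᶠ[𝓝 x₀] 0) : EqOn f 0 U := by
  have key : U ⊆ {x | f =ᶠ[𝓝 x] 0} := by
    refine hc.subset_of_closure_inter_subset isOpen_setOfPred_eventually_nhds ⟨x₀, hx₀, h0⟩ ?_
    rintro x ⟨hxcl, hxU⟩
    obtain ⟨R, hR, hRU⟩ := Metric.isOpen_iff.1 hU x hxU
    obtain ⟨y, hy, hyx⟩ := Metric.mem_closure_iff.1 hxcl R hR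
    rw [dist_comm] at hyx
    -- On the intersection of the ball with the complex line through `y` and `z`, the function
    -- vanishes near `y`, hence also at `z`.
    filter_upwards [isOpen_ball.mem_nhds (mem_ball_self hR)] with z hz
    set ℓ : ℂ → E := fun t => y + t • (z - y) with hℓ
    have hℓd : Differentiable ℂ ℓ := by fun_prop
    set V : Set ℂ := ℓ ⁻¹' ball x R
    have hVo : IsOpen V := isOpen_ball.preimage hℓd.continuous
    have hVc : Convex ℝ V := by
      intro s hs t ht a b ha hb hab
      have : ℓ (a • s + b • t) = a • ℓ s + b • ℓ t := by
        have hab' : (a : ℂ) + b = 1 := by exact_mod_cast hab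
        simp only [hℓ, smul_add, add_smul, smul_assoc]
        have : y = a • y + b • y := by rw [← add_smul, hab, one_smul]
        nth_rewrite 1 [this]
        abel
      change ℓ (a • s + b • t) ∈ ball x R
      rw [this]
      exact convex_ball x R hs ht ha hb hab
    have hfV : DifferentiableOn ℂ (f ∘ ℓ) V :=
      hf.comp hℓd.differentiableOn fun t ht => hRU ht
    have h0V : (0 : ℂ) ∈ V := by simpa [V, hℓ] using hyx
    have h1V : (1 : ℂ) ∈ V := by simpa [V, hℓ] using hz
    have hev : f ∘ ℓ =ᶠ[𝓝 0] 0 := by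
      have ht : Tendsto ℓ (𝓝 0) (𝓝 y) := by
        have := hℓd.continuous.tendsto 0
        simpa [hℓ] using this
      exact ht.eventually hy
    have := (hfV.analyticOnNhd hVo).eqOn_zero_of_preconnected_of_eventuallyEq_zero
      hVc.isPreconnected h0V hev h1V
    simpa [hℓ] using this
  exact fun x hx => (key hx).self_of_nhds

theorem eqOn_zero_or_eqOn_zero_of_mul {E : Type*} [NormedAddCommGroup E] [NormedSpace ℂ E]
    {U : Set E} (hU : IsOpen U) (hc : IsPreconnected U) {f g : E → ℂ}
    (hf : DifferentiableOn ℂ f U) (hg : DifferentiableOn ℂ g U)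
    (h : ∀ x ∈ U, f x * g x = 0) : EqOn f 0 U ∨ EqOn g 0 U := by
  by_cases hf0 : EqOn f 0 U
  · exact Or.inl hf0
  · right
    simp only [EqOn, not_forall] at hf0
    obtain ⟨x, hx, hne⟩ := hf0
    refine eqOn_zero_of_eventuallyEq_zero hU hc hg hx ?_
    have hcont : ContinuousAt f x := (hf.differentiableAt (hU.mem_nhds hx)).continuousAt
    filter_upwards [hcont.eventually_ne hne, hU.mem_nhds hx] with y hy hyU
    exact (mul_eq_zero.1 (h y hyU)).resolve_left hy

/-- A holomorphic map from a domain into the closed unit ball is constant with values on the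
sphere, or has its values in the open ball. -/
theorem forall_eq_or_forall_norm_lt_one {E F : Type*} [NormedAddCommGroup E] [NormedSpace ℂ E]
    [NormedAddCommGroup F] [NormedSpace ℂ F] [StrictConvexSpace ℝ F]
    {U : Set E} (hU : IsOpen U) (hc : IsPreconnected U) {f : E → F}
    (hf : DifferentiableOn ℂ f U) (h1 : ∀ x ∈ U, ‖f x‖ ≤ 1) :
    (∃ c, ‖c‖ = 1 ∧ ∀ x ∈ U, f x = c) ∨ ∀ x ∈ U, ‖f x‖ < 1 := by
  by_cases h : ∃ x ∈ U, ‖f x‖ = 1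
  · obtain ⟨x, hx, hx1⟩ := h
    left
    refine ⟨f x, hx1, fun y hy => ?_⟩
    exact Complex.eqOn_of_isPreconnected_of_isMaxOn_norm hc hU hf hx
      (fun y hy => by simpa [hx1] using h1 y hy) hy
  · right
    push Not at h
    exact fun x hx => lt_of_le_of_ne (h1 x hx) (h x hx)

/-! ### Holomorphic self-maps of the disc with two fixed points -/

/-- The Möbius transformation of the unit disc that sends `0` to `a`. -/
def mobius (a z : ℂ) : ℂ := (z + a) / (1 + conj a * z)

theorem mobius_denom_ne_zero {a z : ℂ} (ha : ‖a‖ < 1) (hz : ‖z‖ ≤ 1) : 1 + conj a * z ≠ 0 := by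
  intro h
  have h1 : conj a * z = -1 := by linear_combination h
  have h2 : ‖a‖ * ‖z‖ = 1 := by simpa using congrArg norm h1
  nlinarith [norm_nonneg a, norm_nonneg z]

theorem mobius_normSq (a z : ℂ) : normSq (1 + conj a * z) - normSq (z + a) =
    (1 - normSq a) * (1 - normSq z) := by
  simp only [normSq_apply, add_re, add_im, mul_re, mul_im, conj_re, conj_im, one_re, one_im]
  ring

theorem norm_mobius_le_one {a z : ℂ} (ha : ‖a‖ < 1) (hz : ‖z‖ ≤ 1) : ‖mobius a z‖ ≤ 1 := by
  have hd := norm_pos_iff.2 (mobius_denom_ne_zero ha hz)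
  rw [mobius, norm_div, div_le_one hd]
  have h := mobius_normSq a z
  simp only [normSq_eq_norm_sq] at h
  have h1 : 0 ≤ (1 - ‖a‖ ^ 2) * (1 - ‖z‖ ^ 2) := by
    apply mul_nonneg <;> nlinarith [norm_nonneg a, norm_nonneg z]
  nlinarith [norm_nonneg (z + a)]

theorem norm_mobius_lt_one {a z : ℂ} (ha : ‖a‖ < 1) (hz : ‖z‖ < 1) : ‖mobius a z‖ < 1 := by
  have hd := norm_pos_iff.2 (mobius_denom_ne_zero ha hz.le)
  rw [mobius, norm_div, div_lt_one hd]
  have h := mobius_normSq a z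
  simp only [normSq_eq_norm_sq] at h
  have h1 : 0 < (1 - ‖a‖ ^ 2) * (1 - ‖z‖ ^ 2) := by
    apply mul_pos <;> nlinarith [norm_nonneg a, norm_nonneg z]
  nlinarith [norm_nonneg (z + a)]

theorem mobius_neg_mobius {a z : ℂ} (ha : ‖a‖ < 1) (hz : ‖z‖ ≤ 1) :
    mobius (-a) (mobius a z) = z := by
  have h1 := mobius_denom_ne_zero ha hz
  have h2 : 1 - conj a * a ≠ 0 := by
    have := mobius_denom_ne_zero (a := -a) (by simpa using ha) ha.le
    simpa [sub_eq_add_neg] using this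
  have h4 : 1 + -conj a * ((z + a) / (1 + conj a * z)) =
      (1 - conj a * a) / (1 + conj a * z) := by
    rw [eq_div_iff h1, add_mul, mul_assoc, div_mul_cancel₀ _ h1]
    ring
  have h5 : (z + a) / (1 + conj a * z) + -a = z * (1 - conj a * a) / (1 + conj a * z) := by
    rw [eq_div_iff h1, add_mul, div_mul_cancel₀ _ h1]
    ring
  simp only [mobius, map_neg]
  rw [h4, h5, div_div_div_cancel_right₀ h1, mul_div_cancel_right₀ _ h2]

theorem mobius_mobius_neg {a z : ℂ} (ha : ‖a‖ < 1) (hz : ‖z‖ ≤ 1) :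
    mobius a (mobius (-a) z) = z := by
  simpa using mobius_neg_mobius (a := -a) (by simpa using ha) hz

theorem differentiableOn_mobius {a : ℂ} (ha : ‖a‖ < 1) :
    DifferentiableOn ℂ (mobius a) (closedBall 0 1) := by
  intro z hz
  have := mobius_denom_ne_zero ha (by simpa using hz)
  unfold mobius
  fun_prop (disch := assumption)

/-- The equality case of the Schwarz–Pick lemma. -/
theorem eqOn_id_of_two_fixed_points {g : ℂ → ℂ} (hg : DifferentiableOn ℂ g (ball 0 1))
    (hmaps : MapsTo g (ball 0 1) (closedBall 0 1)) {a b : ℂ} (ha : ‖a‖ < 1) (hb : ‖b‖ < 1)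
    (hab : a ≠ b) (hga : g a = a) (hgb : g b = b) : EqOn g id (ball 0 1) := by
  have ha' : ‖-a‖ < 1 := by simpa using ha
  -- Conjugation by a Möbius transformation moves the fixed point `a` to `0`.
  set G : ℂ → ℂ := fun z => mobius (-a) (g (mobius a z)) with hG
  have hm : MapsTo (mobius a) (ball 0 1) (ball 0 1) := fun z hz => by
    simpa using norm_mobius_lt_one ha (by simpa using hz)
  have hGd : DifferentiableOn ℂ G (ball 0 1) := by
    refine (differentiableOn_mobius ha').comp (hg.comp ?_ hm) (hmaps.comp hm)
    exact (differentiableOn_mobius ha).mono ball_subset_closedBall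
  have hG0 : G 0 = 0 := by simp [hG, mobius, hga]
  set c := mobius (-a) b
  have hc : ‖c‖ < 1 := norm_mobius_lt_one ha' hb
  have hmc : mobius a c = b := mobius_mobius_neg ha hb.le
  have hGc : G c = c := by simp only [hG, hmc, hgb, c]
  have hc0 : c ≠ 0 := by
    intro h
    rw [h] at hmc
    exact hab (by simpa [mobius] using hmc)
  have hGmaps : MapsTo G (ball 0 1) (closedBall (G 0) 1) := fun z hz => by
    rw [hG0]
    simpa using norm_mobius_le_one ha' (by simpa using hmaps (hm hz))
  have hds : dslope G 0 c = 1 := by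
    rw [dslope_of_ne _ hc0, slope_def_field, hG0, hGc]
    simp [hc0]
  have haff := Complex.affine_of_mapsTo_ball_of_norm_dslope_eq_div hGd hGmaps
    (z₀ := c) (by simpa using hc) (by simp [hds])
  intro z hz
  have hz1 : ‖z‖ < 1 := by simpa using hz
  have hw := norm_mobius_lt_one ha' hz1
  have h1 : G (mobius (-a) z) = mobius (-a) z := by
    have := haff (x := mobius (-a) z) (by simpa using hw)
    simpa [hG0, hds] using this
  have h2 : mobius (-a) (g z) = mobius (-a) z := by
    simpa [hG, mobius_mobius_neg ha hz1.le] using h1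
  have h3 := congrArg (mobius a) h2
  rwa [mobius_mobius_neg ha (by simpa using hmaps hz), mobius_mobius_neg ha hz1.le] at h3

/-! ### Fixed points of holomorphic self-maps of the ball -/

section FixedPoints

variable {E : Type*} [NormedAddCommGroup E] [InnerProductSpace ℂ E]

theorem norm_sq_add_smul {c e : E} (horth : inner ℂ c e = 0) (ζ : ℂ) :
    ‖c + ζ • e‖ ^ 2 = ‖c‖ ^ 2 + ‖ζ‖ ^ 2 * ‖e‖ ^ 2 := by
  rw [norm_add_sq (𝕜 := ℂ), inner_smul_right, horth, norm_smul]
  simp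
  ring

/-- The distance of `z` from a boundary point of the disc `ζ ↦ c + ζ e`; that it is nonnegative
gives the bound for the left inverse of the disc, and its vanishing the case of equality. -/
theorem norm_sq_extremalDisc_sub {c e : E} (horth : inner ℂ c e = 0)
    (h1 : ‖c‖ ^ 2 + ‖e‖ ^ 2 = 1) {ζ : ℂ} (hζ : ‖ζ‖ = 1) (z : E) :
    ‖c + ζ • e - z‖ ^ 2 = 1 + ‖z‖ ^ 2 - 2 * (inner ℂ c z + conj ζ * inner ℂ e z).re := by
  rw [norm_sub_sq (𝕜 := ℂ), norm_sq_add_smul horth, hζ, inner_add_left, inner_smul_left]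
  simp only [RCLike.re_to_complex]
  linear_combination h1

/-- The function `z ↦ ⟪e, z⟫ / (1 - ⟪c, z⟫)`, a left inverse of the affine disc `ζ ↦ c + ζ e`, is
bounded by `1` on the ball. -/
theorem norm_inner_le_norm_one_sub_inner {c e z : E} (horth : inner ℂ c e = 0)
    (h1 : ‖c‖ ^ 2 + ‖e‖ ^ 2 = 1) (hz : ‖z‖ ≤ 1) :
    ‖inner ℂ e z‖ ≤ ‖1 - inner ℂ c z‖ := by
  by_cases h0 : inner ℂ e z = 0
  · simp [h0]
  have hn : (‖inner ℂ e z‖ : ℂ) ≠ 0 := by simpa using h0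
  set ζ : ℂ := inner ℂ e z / ‖inner ℂ e z‖ with hζ
  have hζ1 : ‖ζ‖ = 1 := by
    rw [hζ, norm_div, Complex.norm_real, norm_norm, div_self (by simpa using h0)]
  have hmul : conj ζ * inner ℂ e z = ‖inner ℂ e z‖ := by
    rw [hζ, map_div₀, Complex.conj_ofReal, div_mul_eq_mul_div, Complex.conj_mul', sq,
      mul_div_assoc, div_self hn, mul_one]
  have h := norm_sq_extremalDisc_sub horth h1 hζ1 z
  rw [hmul, add_re, ofReal_re] at h
  have h2 : (1 - inner ℂ c z).re ≤ ‖1 - inner ℂ c z‖ := re_le_norm _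
  rw [sub_re, one_re] at h2
  nlinarith [sq_nonneg ‖c + ζ • e - z‖, norm_nonneg z]

theorem eq_of_inner_eq_mul {c e z : E} (horth : inner ℂ c e = 0)
    (h1 : ‖c‖ ^ 2 + ‖e‖ ^ 2 = 1) (hz : ‖z‖ ≤ 1) {ζ : ℂ} (hζ : ‖ζ‖ = 1)
    (h : inner ℂ e z = ζ * (1 - inner ℂ c z)) : z = c + ζ • e := by
  have hs := norm_sq_extremalDisc_sub horth h1 hζ z
  have hcc : conj ζ * ζ = 1 := by rw [Complex.conj_mul', hζ]; simp
  have : inner ℂ c z + conj ζ * inner ℂ e z = 1 := by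
    rw [h, ← mul_assoc, hcc]; ring
  rw [this, one_re] at hs
  have h0 : ‖c + ζ • e - z‖ ^ 2 ≤ 0 := by nlinarith [norm_nonneg z]
  have h00 : ‖c + ζ • e - z‖ = 0 := by
    have := sq_nonneg ‖c + ζ • e - z‖
    exact pow_eq_zero_iff two_ne_zero |>.1 (le_antisymm h0 this)
  exact (sub_eq_zero.1 (norm_eq_zero.1 h00)).symm

/-- The disc `ζ ↦ c + ζ e`, with `c` orthogonal to `e` and `‖c‖ ^ 2 + ‖e‖ ^ 2 = 1`, is the
intersection of a complex line with the ball. If two of its points are fixed, then all are: composed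
with the left inverse of the disc, the map is a self-map of the unit disc with two fixed points. -/
theorem fixed_on_extremalDisc {τ : E → E} (hd : DifferentiableOn ℂ τ (ball 0 1))
    (hcont : ContinuousOn τ (closedBall 0 1)) (hmaps : MapsTo τ (closedBall 0 1) (closedBall 0 1))
    {c e : E} (horth : inner ℂ c e = 0) (h1 : ‖c‖ ^ 2 + ‖e‖ ^ 2 = 1) (he : e ≠ 0)
    {a b : ℂ} (ha : ‖a‖ < 1) (hb : ‖b‖ < 1) (hab : a ≠ b)
    (hτa : τ (c + a • e) = c + a • e) (hτb : τ (c + b • e) = c + b • e)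
    {ζ : ℂ} (hζ : ‖ζ‖ < 1) : τ (c + ζ • e) = c + ζ • e := by
  have he0 : 0 < ‖e‖ := norm_pos_iff.2 he
  have hc1 : ‖c‖ < 1 := by nlinarith [norm_nonneg c]
  set δ : ℂ → E := fun ζ => c + ζ • e with hδ
  have hδd : Differentiable ℂ δ := by fun_prop
  have hδball : MapsTo δ (ball 0 1) (ball 0 1) := fun z hz => by
    have hz' : ‖z‖ < 1 := by simpa using hz
    have := norm_sq_add_smul horth z
    simp only [mem_ball_zero_iff, hδ]
    have h2 : ‖z‖ ^ 2 < 1 := by nlinarith [norm_nonneg z]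
    have h3 : ‖c + z • e‖ ^ 2 < 1 := by nlinarith [sq_nonneg ‖e‖, pow_pos he0 2]
    nlinarith [norm_nonneg (c + z • e)]
  have hδcl : MapsTo δ (closedBall 0 1) (closedBall 0 1) := fun z hz => by
    have hz' : ‖z‖ ≤ 1 := by simpa using hz
    have := norm_sq_add_smul horth z
    simp only [mem_closedBall_zero_iff, hδ]
    have h2 : ‖z‖ ^ 2 ≤ 1 := by nlinarith [norm_nonneg z]
    have h3 : ‖c + z • e‖ ^ 2 ≤ 1 := by nlinarith [sq_nonneg ‖e‖, pow_pos he0 2]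
    nlinarith [norm_nonneg (c + z • e)]
  set f : ℂ → E := τ ∘ δ with hf
  have hfd : DifferentiableOn ℂ f (ball 0 1) := hd.comp hδd.differentiableOn hδball
  have hfc : ContinuousOn f (closedBall 0 1) := hcont.comp hδd.continuous.continuousOn hδcl
  have hfm : MapsTo f (closedBall 0 1) (closedBall 0 1) := hmaps.comp hδcl
  have hden (z : ℂ) (hz : z ∈ closedBall (0 : ℂ) 1) : 1 - inner ℂ c (f z) ≠ 0 := by
    intro h
    have h2 : ‖f z‖ ≤ 1 := by simpa using hfm hz
    have h3 : inner ℂ c (f z) = 1 := (sub_eq_zero.1 h).symm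
    have h4 := norm_inner_le_norm (𝕜 := ℂ) c (f z)
    rw [h3, norm_one] at h4
    nlinarith [norm_nonneg c, norm_nonneg (f z)]
  set g : ℂ → ℂ := fun z => innerSL ℂ e (f z) / (1 - innerSL ℂ c (f z)) with hg
  have hgd : DifferentiableOn ℂ g (ball 0 1) :=
    ((innerSL ℂ e).differentiable.comp_differentiableOn hfd).div
      (((innerSL ℂ c).differentiable.comp_differentiableOn hfd).const_sub 1)
      fun z hz => hden z (ball_subset_closedBall hz)
  have hgc : ContinuousOn g (closedBall 0 1) :=
    ((innerSL ℂ e).continuous.comp_continuousOn hfc).div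
      (continuousOn_const.sub ((innerSL ℂ c).continuous.comp_continuousOn hfc)) hden
  have hgm : MapsTo g (ball 0 1) (closedBall 0 1) := fun z hz => by
    have hz' := ball_subset_closedBall hz
    simp only [mem_closedBall_zero_iff, hg, norm_div, innerSL_apply_apply]
    rw [div_le_one (norm_pos_iff.2 (hden z hz'))]
    exact norm_inner_le_norm_one_sub_inner horth h1 (by simpa using hfm hz')
  have hfix (z : ℂ) (hz : f z = δ z) : g z = z := by
    have h2 : (1 : ℂ) - (‖c‖ : ℂ) ^ 2 = (‖e‖ : ℂ) ^ 2 := by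
      rw [sub_eq_iff_eq_add, add_comm]; exact_mod_cast h1.symm
    have h3 : inner ℂ e c = 0 := inner_eq_zero_symm.1 horth
    have h4 : (‖e‖ : ℂ) ^ 2 ≠ 0 := by simpa using he
    simp only [hg, hz, hδ, innerSL_apply_apply, inner_add_right, inner_smul_right, horth, h3,
      inner_self_eq_norm_sq_to_K, mul_zero, add_zero, zero_add]
    change z * (‖e‖ : ℂ) ^ 2 / (1 - (‖c‖ : ℂ) ^ 2) = z
    rw [h2, mul_div_cancel_right₀ _ h4]
  have hid : EqOn g id (ball 0 1) :=
    eqOn_id_of_two_fixed_points hgd hgm ha hb hab (hfix a hτa) (hfix b hτb)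
  have hcl : closure (ball (0 : ℂ) 1) = closedBall 0 1 := closure_ball 0 one_ne_zero
  have hid' : EqOn g id (closedBall 0 1) :=
    hid.of_subset_closure hgc continuousOn_id ball_subset_closedBall hcl.ge
  -- On the unit circle the bound for the left inverse is attained, which determines the value
  -- of `f`.
  have hfr : EqOn f δ (frontier (ball 0 1)) := fun z hz => by
    rw [frontier_ball 0 one_ne_zero, mem_sphere_zero_iff_norm] at hz
    have hz' : z ∈ closedBall (0 : ℂ) 1 := by simp [hz]
    refine eq_of_inner_eq_mul horth h1 (by simpa using hfm hz') hz ?_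
    have := hid' hz'
    simp only [hg, id, innerSL_apply_apply] at this
    rwa [div_eq_iff (hden z hz')] at this
  exact Complex.eqOn_of_eqOn_frontier isBounded_ball ⟨hfd, by rwa [hcl]⟩ hδd.diffContOnCl hfr
    (by simpa using hζ)

/-- If two points of the ball are fixed, then so are all points of the ball on the complex line
through them. -/
theorem fixed_on_line {τ : E → E} (hd : DifferentiableOn ℂ τ (ball 0 1))
    (hcont : ContinuousOn τ (closedBall 0 1)) (hmaps : MapsTo τ (closedBall 0 1) (closedBall 0 1))
    {p q : E} (hp : ‖p‖ < 1) (hq : ‖q‖ < 1) (hτp : τ p = p) (hτq : τ q = q)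
    {t : ℂ} (ht : ‖p + t • (q - p)‖ < 1) : τ (p + t • (q - p)) = p + t • (q - p) := by
  by_cases hpq : p = q
  · simpa [hpq] using hτq
  set d := q - p with hd'
  have hd0 : d ≠ 0 := sub_ne_zero.2 (Ne.symm hpq)
  have hdn : (‖d‖ : ℂ) ≠ 0 := by simpa using hd0
  -- `c` is the point of the line that is closest to the origin.
  set l : ℂ := inner ℂ d p / (‖d‖ : ℂ) ^ 2 with hl
  set c := p - l • d with hc
  have hdc : inner ℂ d c = 0 := by
    rw [hc, inner_sub_right, inner_smul_right, inner_self_eq_norm_sq_to_K, hl]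
    change inner ℂ d p - inner ℂ d p / (‖d‖ : ℂ) ^ 2 * (‖d‖ : ℂ) ^ 2 = 0
    rw [div_mul_cancel₀ _ (pow_ne_zero 2 hdn), sub_self]
  have hcd : inner ℂ c d = 0 := inner_eq_zero_symm.1 hdc
  have hpt (s : ℂ) : p + s • d = c + (l + s) • d := by
    rw [hc, add_smul]; abel
  have hpc : ‖c‖ ^ 2 < 1 := by
    have h := norm_sq_add_smul hcd l
    have h2 : c + l • d = p := by rw [hc]; abel
    rw [h2] at h
    nlinarith [norm_nonneg p, mul_nonneg (sq_nonneg ‖l‖) (sq_nonneg ‖d‖)]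
  set s := √(1 - ‖c‖ ^ 2) with hs
  have hs0 : 0 < s := Real.sqrt_pos.2 (by linarith)
  have hs2 : s ^ 2 = 1 - ‖c‖ ^ 2 := Real.sq_sqrt (by linarith)
  have hsC : (s : ℂ) ≠ 0 := by exact_mod_cast hs0.ne'
  set e : E := ((s : ℂ) / ‖d‖) • d with he
  have hen : ‖e‖ = s := by
    rw [he, norm_smul, norm_div]
    simp only [Complex.norm_real, Real.norm_eq_abs, abs_of_pos hs0, abs_norm]
    exact div_mul_cancel₀ _ (norm_ne_zero_iff.2 hd0)
  have horth : inner ℂ c e = 0 := by rw [he, inner_smul_right, hcd, mul_zero]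
  have h1 : ‖c‖ ^ 2 + ‖e‖ ^ 2 = 1 := by rw [hen, hs2]; ring
  have he0 : e ≠ 0 := norm_ne_zero_iff.1 (by rw [hen]; exact hs0.ne')
  have hpe (s' : ℂ) : p + s' • d = c + ((l + s') * (‖d‖ / s)) • e := by
    rw [hpt, he, smul_smul, mul_assoc, div_mul_div_comm, mul_comm (‖d‖ : ℂ), div_self, mul_one]
    exact mul_ne_zero hsC hdn
  have hlt (ζ : ℂ) (h : ‖c + ζ • e‖ < 1) : ‖ζ‖ < 1 := by
    have h2 := norm_sq_add_smul horth ζ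
    have h3 : ‖c + ζ • e‖ ^ 2 < 1 := by nlinarith [norm_nonneg (c + ζ • e)]
    have h4 : 0 < ‖e‖ ^ 2 := by rw [hen]; positivity
    by_contra h5
    push Not at h5
    have h6 : 1 ≤ ‖ζ‖ ^ 2 := one_le_pow₀ h5
    nlinarith
  have hp0 : p = p + (0 : ℂ) • d := by simp
  have hq1 : q = p + (1 : ℂ) • d := by simp [hd']
  rw [hpe] at ht hp0 hq1 ⊢
  refine fixed_on_extremalDisc hd hcont hmaps horth h1 he0
    (a := (l + 0) * (‖d‖ / s)) (b := (l + 1) * (‖d‖ / s)) ?_ ?_ ?_ ?_ ?_ (hlt _ ht)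
  · exact hlt _ (by rwa [← hp0])
  · exact hlt _ (by rwa [← hq1])
  · intro h
    have := mul_right_cancel₀ (div_ne_zero hdn hsC) h
    simp at this
  · rwa [← hp0]
  · rwa [← hq1]

/-- The fixed points in the ball of a holomorphic self-map of the ball are the points of an affine
subspace. -/
theorem exists_submodule_fixedPoints {τ : E → E} (hd : DifferentiableOn ℂ τ (ball 0 1))
    (hcont : ContinuousOn τ (closedBall 0 1)) (hmaps : MapsTo τ (closedBall 0 1) (closedBall 0 1))
    {p : E} (hp : ‖p‖ < 1) (hτp : τ p = p) :
    ∃ V : Submodule ℂ E, ∀ v, ‖p + v‖ < 1 → (τ (p + v) = p + v ↔ v ∈ V) := by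
  have hline {x y : E} (hx : ‖x‖ < 1) (hy : ‖y‖ < 1) (hτx : τ x = x) (hτy : τ y = y)
      {t : ℂ} (ht : ‖x + t • (y - x)‖ < 1) : τ (x + t • (y - x)) = x + t • (y - x) :=
    fixed_on_line hd hcont hmaps hx hy hτx hτy ht
  -- A fixed point `p + v` with `v ≠ 0` makes all of the line through `p` and `p + v` fixed.
  have hray {v : E} (hv : ‖p + v‖ < 1) (hτv : τ (p + v) = p + v) {t : ℂ}
      (ht : ‖p + t • v‖ < 1) : τ (p + t • v) = p + t • v := by
    have := hline hp hv hτp hτv (t := t) (by simpa using ht)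
    simpa using this
  have hsmall (v w : E) : ∃ r : ℂ, r ≠ 0 ∧ ‖p + r • v‖ < 1 ∧ ‖p + r • w‖ < 1 := by
    have hcon (v : E) : Tendsto (fun r : ℂ => ‖p + r • v‖) (𝓝[≠] 0) (𝓝 ‖p + (0 : ℂ) • v‖) :=
      ((by fun_prop : Continuous fun r : ℂ => ‖p + r • v‖).tendsto 0).mono_left
        nhdsWithin_le_nhds
    have h1 (v : E) : ∀ᶠ r : ℂ in 𝓝[≠] 0, ‖p + r • v‖ < 1 :=
      (tendsto_order.1 (hcon v)).2 1 (by simpa using hp)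
    obtain ⟨r, ⟨hr, hr'⟩, hr0⟩ := (((h1 v).and (h1 w)).and self_mem_nhdsWithin).exists
    exact ⟨r, hr0, hr, hr'⟩
  refine ⟨{ carrier := {v | ∀ t : ℂ, ‖p + t • v‖ < 1 → τ (p + t • v) = p + t • v}
            zero_mem' := fun t _ => by simpa using hτp
            smul_mem' := fun r v hv t ht => ?_
            add_mem' := fun {v w} hv hw t ht => ?_ }, fun v hv => ⟨fun h t ht => ?_, fun h => ?_⟩⟩
  · obtain ⟨r, hr0, hrv, hrw⟩ := hsmall v w
    have hmid : p + r • v + (1 / 2 : ℂ) • (p + r • w - (p + r • v)) =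
        p + (r / 2) • (v + w) := by module
    have hmid1 : ‖p + (r / 2) • (v + w)‖ < 1 := by
      have : p + (r / 2) • (v + w) = (1 / 2 : ℂ) • (p + r • v) + (1 / 2 : ℂ) • (p + r • w) := by
        module
      rw [this]
      refine (norm_add_le _ _).trans_lt ?_
      rw [norm_smul, norm_smul]
      norm_num
      linarith
    have hτmid := hline hrv hrw (hv r hrv) (hw r hrw) (t := 1 / 2) (by rwa [hmid])
    rw [hmid] at hτmid
    have hre : t • (v + w) = (t / (r / 2)) • ((r / 2) • (v + w)) := by
      rw [smul_smul, div_mul_cancel₀]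
      exact div_ne_zero hr0 two_ne_zero
    rw [hre] at ht ⊢
    exact hray hmid1 hτmid ht
  · rw [smul_smul] at ht ⊢
    exact hv _ ht
  · exact hray hv h ht
  · simpa using h 1 (by simpa using hv)

end FixedPoints

/-! ### Characters of Banach algebras -/

section Characters

variable {A : Type*} [NormedRing A] [NormedAlgebra ℂ A]

/-- A continuous unital algebra homomorphism into `ℂ` as a character. -/
def characterOfAlgHom (θ : A →ₐ[ℂ] ℂ) (hθ : Continuous θ) : WeakDual.characterSpace ℂ A :=
  ⟨StrongDual.toWeakDual ⟨θ.toLinearMap, hθ⟩, by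
    rw [WeakDual.CharacterSpace.eq_set_map_one_map_mul]
    exact ⟨map_one θ, map_mul θ⟩⟩

theorem continuous_character_apply (a : A) :
    Continuous fun θ : WeakDual.characterSpace ℂ A => θ a :=
  (WeakDual.eval_continuous a).comp continuous_subtype_val

theorem norm_character_apply_le [CompleteSpace A] (θ : WeakDual.characterSpace ℂ A) (a : A) :
    ‖θ a‖ ≤ ‖a‖ * ‖(1 : A)‖ :=
  AlgHom.norm_apply_le_self_mul_norm_one θ a

theorem compactSpace_characterSpace [CompleteSpace A] :
    CompactSpace (WeakDual.characterSpace ℂ A) := inferInstance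

/-- The elements of a Banach algebra whose Gelfand transform is holomorphic along `h` form a closed
set, because characters are contractive up to the constant `‖1‖`. -/
theorem isClosed_setOf_differentiableOn [CompleteSpace A] {E : Type*} [NormedAddCommGroup E]
    [NormedSpace ℂ E] {Ω : Set E} (hΩ : IsOpen Ω) (h : E → WeakDual.characterSpace ℂ A) :
    IsClosed {a : A | DifferentiableOn ℂ (fun w => h w a) Ω} := by
  refine isClosed_of_closure_subset fun a ha => ?_
  refine differentiableOn_of_uniform_approx hΩ fun ε hε => ?_
  have hC : 0 < ‖(1 : A)‖ + 1 := by positivity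
  obtain ⟨b, hb, hab⟩ := Metric.mem_closure_iff.1 ha (ε / (‖(1 : A)‖ + 1)) (by positivity)
  refine ⟨_, hb, fun w _ => ?_⟩
  rw [← map_sub]
  refine (norm_character_apply_le (h w) (a - b)).trans ?_
  rw [dist_eq_norm, lt_div_iff₀ hC] at hab
  nlinarith [norm_nonneg (a - b)]

end Characters

/-! ### The Fock space and the creation operators -/

open scoped Classical in
/-- The basis vector of the Fock space at a word. -/
def wordVec {n : ℕ} (w : FreeMonoid (Fin n)) : Fock n := lp.single 2 w 1

/-- The vacuum vector: the basis vector at the empty word. -/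
def vacuum (n : ℕ) : Fock n := wordVec 1

/-- The left creation operator as a continuous linear map. -/
abbrev creationOp (n : ℕ) (i : Fin n) : Fock n →L[ℂ] Fock n :=
  (creationIsometry n i).toContinuousLinearMap

section Fock

variable {n : ℕ}

theorem coe_discGen (i : Fin n) : (discGen n i : Fock n →L[ℂ] Fock n) = creationOp n i := rfl

theorem creationOp_apply (i : Fin n) (f : Fock n) (w : FreeMonoid (Fin n)) :
    creationOp n i f w = Function.extend (prefixLetter i) (f : FreeMonoid (Fin n) → ℂ) 0 w := rfl

theorem creationOp_prefixLetter (i : Fin n) (f : Fock n) (w : FreeMonoid (Fin n)) :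
    creationOp n i f (FreeMonoid.of i * w) = f w := by
  rw [creationOp_apply]
  exact (prefixLetter_injective i).extend_apply _ _ w

theorem creationOp_of_not_exists (i : Fin n) (f : Fock n) (w : FreeMonoid (Fin n))
    (h : ¬∃ v, prefixLetter i v = w) : creationOp n i f w = 0 := by
  rw [creationOp_apply, Function.extend_apply' _ _ _ h]
  rfl

theorem creationOp_one (i : Fin n) (f : Fock n) : creationOp n i f 1 = 0 := by
  refine creationOp_of_not_exists i f 1 ?_
  rintro ⟨v, hv⟩
  exact List.cons_ne_nil _ _ (congrArg FreeMonoid.toList hv)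

open scoped Classical in
theorem wordVec_apply (w v : FreeMonoid (Fin n)) :
    wordVec w v = if v = w then 1 else 0 := by
  rw [wordVec, lp.single_apply, Pi.single_apply]

theorem inner_wordVec_left (w : FreeMonoid (Fin n)) (f : Fock n) : inner ℂ (wordVec w) f = f w := by
  classical
  rw [wordVec, lp.inner_single_left]
  simp

theorem norm_wordVec (w : FreeMonoid (Fin n)) : ‖wordVec w‖ = 1 := by
  classical
  rw [wordVec, lp.norm_single (by norm_num)]
  simp

theorem orthonormal_wordVec : Orthonormal ℂ (wordVec (n := n)) := by
  classical
  refine ⟨norm_wordVec, fun v w h => ?_⟩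
  change inner ℂ (wordVec v) (wordVec w) = 0
  rw [inner_wordVec_left, wordVec_apply, if_neg h]

theorem creationOp_wordVec (i : Fin n) (w : FreeMonoid (Fin n)) :
    creationOp n i (wordVec w) = wordVec (FreeMonoid.of i * w) := by
  classical
  ext v
  by_cases hv : ∃ u, prefixLetter i u = v
  · obtain ⟨u, rfl⟩ := hv
    change creationOp n i (wordVec w) (FreeMonoid.of i * u) = wordVec _ (FreeMonoid.of i * u)
    rw [creationOp_prefixLetter, wordVec_apply, wordVec_apply]
    simp
  · rw [creationOp_of_not_exists i _ v hv, wordVec_apply, if_neg]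
    rintro rfl
    exact hv ⟨w, rfl⟩

theorem inner_creationOp_self (i : Fin n) (f g : Fock n) :
    inner ℂ (creationOp n i f) (creationOp n i g) = inner ℂ f g :=
  (creationIsometry n i).inner_map_map f g

theorem inner_creationOp_of_ne {i j : Fin n} (hij : i ≠ j) (f g : Fock n) :
    inner ℂ (creationOp n i f) (creationOp n j g) = 0 := by
  rw [lp.inner_eq_tsum]
  refine (tsum_congr fun w => ?_).trans tsum_zero
  by_cases hi : ∃ v, prefixLetter i v = w
  · rw [creationOp_of_not_exists j g w, inner_zero_right]
    rintro ⟨u, hu⟩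
    obtain ⟨v, hv⟩ := hi
    have h := congrArg FreeMonoid.toList (hv.trans hu.symm)
    exact hij (List.cons.inj h).1
  · rw [creationOp_of_not_exists i f w hi, inner_zero_left]

theorem inner_vacuum_creationOp (i : Fin n) (f : Fock n) :
    inner ℂ (vacuum n) (creationOp n i f) = 0 := by
  rw [vacuum, inner_wordVec_left, creationOp_one]

/-- The operator `∑ a i • S i`. -/
def rowOp (a : EuclideanSpace ℂ (Fin n)) : discAlgebra n := ∑ i, a i • discGen n i

theorem coe_rowOp_apply (a : EuclideanSpace ℂ (Fin n)) (f : Fock n) :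
    (rowOp a : Fock n →L[ℂ] Fock n) f = ∑ i, a i • creationOp n i f := by
  rw [rowOp, AddSubmonoidClass.coe_finsetSum, sum_apply]
  rfl

theorem norm_rowOp_apply (a : EuclideanSpace ℂ (Fin n)) (f : Fock n) :
    ‖(rowOp a : Fock n →L[ℂ] Fock n) f‖ = ‖a‖ * ‖f‖ := by
  have h : inner ℂ ((rowOp a : Fock n →L[ℂ] Fock n) f) ((rowOp a : Fock n →L[ℂ] Fock n) f) =
      ((‖a‖ * ‖f‖ : ℝ) : ℂ) ^ 2 := by
    rw [coe_rowOp_apply, sum_inner]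
    have h1 (i : Fin n) : inner ℂ (a i • creationOp n i f) (∑ j, a j • creationOp n j f) =
        ((‖a i‖ ^ 2 * ‖f‖ ^ 2 : ℝ) : ℂ) := by
      rw [inner_sum, Finset.sum_eq_single i]
      · rw [inner_smul_left, inner_smul_right, inner_creationOp_self, inner_self_eq_norm_sq_to_K,
          ← mul_assoc, Complex.conj_mul']
        push_cast
        rfl
      · intro j _ hj
        rw [inner_smul_left, inner_smul_right, inner_creationOp_of_ne hj.symm, mul_zero, mul_zero]
      · simp
    rw [Finset.sum_congr rfl fun i _ => h1 i, ← Complex.ofReal_sum, ← Finset.sum_mul,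
      ← EuclideanSpace.norm_sq_eq, ← mul_pow, Complex.ofReal_pow]
  rw [inner_self_eq_norm_sq_to_K] at h
  change (‖(rowOp a : Fock n →L[ℂ] Fock n) f‖ : ℂ) ^ 2 = _ at h
  have h' : ‖(rowOp a : Fock n →L[ℂ] Fock n) f‖ ^ 2 = (‖a‖ * ‖f‖) ^ 2 := by exact_mod_cast h
  exact (sq_eq_sq₀ (norm_nonneg _) (by positivity)).1 h'

theorem norm_rowOp_le (a : EuclideanSpace ℂ (Fin n)) : ‖rowOp a‖ ≤ ‖a‖ :=
  ContinuousLinearMap.opNorm_le_bound _ (norm_nonneg _) fun f => (norm_rowOp_apply a f).le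

/-! ### The noncommutative disc algebra -/

instance : CompleteSpace (discAlgebra n) :=
  (Subalgebra.isClosed_topologicalClosure _).completeSpace_coe

instance : CompactSpace (WeakDual.characterSpace ℂ (discAlgebra n)) :=
  compactSpace_characterSpace

theorem norm_one_discAlgebra_le : ‖(1 : discAlgebra n)‖ ≤ 1 := ContinuousLinearMap.norm_id_le

theorem norm_discCharacter_apply_le (θ : WeakDual.characterSpace ℂ (discAlgebra n))
    (a : discAlgebra n) : ‖θ a‖ ≤ ‖a‖ :=
  (norm_character_apply_le θ a).trans
    (mul_le_of_le_one_right (norm_nonneg a) norm_one_discAlgebra_le)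

/-- Closed properties that are stable under the algebra operations hold on the noncommutative disc
algebra as soon as they hold for its generators. -/
theorem discAlgebra_induction {P : discAlgebra n → Prop} (hgen : ∀ i, P (discGen n i))
    (hscalar : ∀ c, P (algebraMap ℂ _ c)) (hadd : ∀ a b, P a → P b → P (a + b))
    (hmul : ∀ a b, P a → P b → P (a * b)) (hclosed : IsClosed {a | P a}) (a : discAlgebra n) :
    P a := by
  set D : Subalgebra ℂ (discAlgebra n) := Algebra.adjoin ℂ (range (discGen n))
  have hD : ∀ b ∈ D, P b := fun b hb => by
    induction hb using Algebra.adjoin_induction with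
    | mem x hx => obtain ⟨i, rfl⟩ := hx; exact hgen i
    | algebraMap c => exact hscalar c
    | add x y _ _ hx hy => exact hadd x y hx hy
    | mul x y _ _ hx hy => exact hmul x y hx hy
  have hmap : Subtype.val '' (D : Set (discAlgebra n)) =
      (Algebra.adjoin ℂ (range fun i : Fin n => creationOp n i) : Set (Fock n →L[ℂ] Fock n)) := by
    have := (discAlgebra n).val.map_adjoin (range (discGen n))
    rw [← range_comp] at this
    exact congrArg (SetLike.coe) this
  have ha : a ∈ closure (D : Set (discAlgebra n)) := by
    rw [Topology.IsInducing.subtypeVal.closure_eq_preimage_closure_image]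
    exact (congrArg closure hmap).ge a.2
  exact hclosed.closure_subset_iff.2 hD ha

theorem character_ext {θ₁ θ₂ : WeakDual.characterSpace ℂ (discAlgebra n)}
    (h : ∀ i, θ₁ (discGen n i) = θ₂ (discGen n i)) : θ₁ = θ₂ := by
  ext a
  induction a using discAlgebra_induction with
  | hgen i => exact h i
  | hscalar c => rw [AlgHomClass.commutes, AlgHomClass.commutes]
  | hadd a b ha hb => rw [map_add, map_add, ha, hb]
  | hmul a b ha hb => rw [map_mul, map_mul, ha, hb]
  | hclosed => exact isClosed_eq (map_continuous θ₁) (map_continuous θ₂)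

/-- The point `(θ (S 1), …, θ (S n))` of a character `θ` of the noncommutative disc algebra. -/
def discCoords (θ : WeakDual.characterSpace ℂ (discAlgebra n)) : EuclideanSpace ℂ (Fin n) :=
  WithLp.toLp 2 fun i => θ (discGen n i)

theorem discCoords_apply (θ : WeakDual.characterSpace ℂ (discAlgebra n)) (i : Fin n) :
    discCoords θ i = θ (discGen n i) := rfl

theorem discCoords_injective : Function.Injective (discCoords (n := n)) := fun θ₁ θ₂ h =>
  character_ext fun i => by rw [← discCoords_apply, h, discCoords_apply]

theorem continuous_discCoords : Continuous (discCoords (n := n)) :=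
  (PiLp.continuous_toLp 2 _).comp (continuous_pi fun i => continuous_character_apply (discGen n i))

theorem norm_discCoords_le_one (θ : WeakDual.characterSpace ℂ (discAlgebra n)) :
    ‖discCoords θ‖ ≤ 1 := by
  set z := discCoords θ
  set a : EuclideanSpace ℂ (Fin n) := WithLp.toLp 2 fun i => conj (z i)
  have ha : ‖a‖ = ‖z‖ := by simp [EuclideanSpace.norm_eq, a]
  have h1 : θ (rowOp a) = ((‖z‖ ^ 2 : ℝ) : ℂ) := by
    rw [rowOp, map_sum, EuclideanSpace.norm_sq_eq, Complex.ofReal_sum]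
    refine Finset.sum_congr rfl fun i _ => ?_
    rw [map_smul, ← discCoords_apply, smul_eq_mul]
    change conj (z i) * z i = _
    rw [Complex.conj_mul']
    push_cast
    rfl
  have h2 := (norm_discCharacter_apply_le θ (rowOp a)).trans (norm_rowOp_le a)
  rw [h1, ha, Complex.norm_real, Real.norm_of_nonneg (sq_nonneg _)] at h2
  nlinarith [norm_nonneg z]

/-- The character at a point `z` of the open ball is a vector functional: it is given by a joint
eigenvector `v` of the adjoints of the creation operators, which the Neumann series of
`∑ conj (z i) • S i` yields. -/
theorem exists_character_of_norm_lt_one {z : EuclideanSpace ℂ (Fin n)} (hz : ‖z‖ < 1) :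
    ∃ (θ : WeakDual.characterSpace ℂ (discAlgebra n)) (v : Fock n), discCoords θ = z ∧
      v = vacuum n + ∑ i, conj (z i) • creationOp n i v ∧
      ∀ a : discAlgebra n, θ a = inner ℂ v ((a : Fock n →L[ℂ] Fock n) (vacuum n)) := by
  set c : EuclideanSpace ℂ (Fin n) := WithLp.toLp 2 fun i => conj (z i) with hc
  have hcz : ‖c‖ = ‖z‖ := by simp [EuclideanSpace.norm_eq, hc]
  have hT : ‖(rowOp c : Fock n →L[ℂ] Fock n)‖ < 1 := by
    refine lt_of_le_of_lt ?_ hz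
    rw [← hcz]
    exact norm_rowOp_le c
  obtain ⟨v, hv⟩ : ∃ v, v = vacuum n + ∑ i, conj (z i) • creationOp n i v := by
    refine ⟨(↑(Units.oneSub _ hT)⁻¹ : Fock n →L[ℂ] Fock n) (vacuum n), ?_⟩
    have h1 := Units.mul_inv (Units.oneSub _ hT)
    have h2 : (↑(Units.oneSub _ hT)⁻¹ : Fock n →L[ℂ] Fock n) (vacuum n) -
        (rowOp c : Fock n →L[ℂ] Fock n)
          ((↑(Units.oneSub _ hT)⁻¹ : Fock n →L[ℂ] Fock n) (vacuum n)) = vacuum n :=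
      congrArg (fun B : Fock n →L[ℂ] Fock n => B (vacuum n)) h1
    rw [coe_rowOp_apply] at h2
    exact sub_eq_iff_eq_add.1 h2
  have hgen (i : Fin n) (f : Fock n) : inner ℂ v (creationOp n i f) = z i * inner ℂ v f := by
    conv_lhs => rw [hv]
    rw [inner_add_left, inner_vacuum_creationOp, zero_add, sum_inner, Finset.sum_eq_single i]
    · rw [inner_smul_left, inner_creationOp_self, Complex.conj_conj]
    · intro j _ hj
      rw [inner_smul_left, inner_creationOp_of_ne hj, mul_zero]
    · simp
  have hvac : inner ℂ v (vacuum n) = 1 := by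
    rw [← inner_conj_symm, hv, inner_add_right, inner_sum]
    have : ∑ i, inner ℂ (vacuum n) (conj (z i) • creationOp n i v) = 0 :=
      Finset.sum_eq_zero fun i _ => by
        rw [inner_smul_right, inner_vacuum_creationOp, mul_zero]
    rw [this, inner_self_eq_norm_sq_to_K, vacuum, norm_wordVec]
    simp
  have hcont (f : Fock n) :
      Continuous fun a : discAlgebra n => inner ℂ v ((a : Fock n →L[ℂ] Fock n) f) := by
    have : Continuous fun a : discAlgebra n => (a : Fock n →L[ℂ] Fock n) f :=
      (ContinuousLinearMap.apply ℂ (Fock n) f).continuous.comp continuous_subtype_val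
    fun_prop
  have hmulv (a : discAlgebra n) : ∀ f, inner ℂ v ((a : Fock n →L[ℂ] Fock n) f) =
      inner ℂ v ((a : Fock n →L[ℂ] Fock n) (vacuum n)) * inner ℂ v f := by
    induction a using discAlgebra_induction with
    | hgen i => intro f; rw [coe_discGen, hgen, hgen, hvac, mul_one]
    | hscalar c =>
      intro f
      change inner ℂ v ((algebraMap ℂ (Fock n →L[ℂ] Fock n) c) f) =
        inner ℂ v ((algebraMap ℂ (Fock n →L[ℂ] Fock n) c) (vacuum n)) * inner ℂ v f
      rw [ContinuousLinearMap.algebraMap_apply, ContinuousLinearMap.algebraMap_apply,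
        inner_smul_right, inner_smul_right, hvac, mul_one]
    | hadd a b ha hb =>
      intro f
      change inner ℂ v ((a : Fock n →L[ℂ] Fock n) f + (b : Fock n →L[ℂ] Fock n) f) =
        inner ℂ v ((a : Fock n →L[ℂ] Fock n) (vacuum n) + (b : Fock n →L[ℂ] Fock n) (vacuum n)) *
          inner ℂ v f
      rw [inner_add_right, inner_add_right, ha, hb, add_mul]
    | hmul a b ha hb =>
      intro f
      change inner ℂ v ((a : Fock n →L[ℂ] Fock n) ((b : Fock n →L[ℂ] Fock n) f)) =
        inner ℂ v ((a : Fock n →L[ℂ] Fock n) ((b : Fock n →L[ℂ] Fock n) (vacuum n))) *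
          inner ℂ v f
      rw [ha, hb, ha ((b : Fock n →L[ℂ] Fock n) (vacuum n)), mul_assoc]
    | hclosed =>
      rw [ofPred_forall]
      exact isClosed_iInter fun f => isClosed_eq (hcont f) ((hcont _).mul continuous_const)
  let θ : discAlgebra n →ₐ[ℂ] ℂ := AlgHom.ofLinearMap
    { toFun := fun a => inner ℂ v ((a : Fock n →L[ℂ] Fock n) (vacuum n))
      map_add' := fun a b => inner_add_right v _ _
      map_smul' := fun c a => inner_smul_right v _ c } hvac (fun a b => hmulv a _)
  refine ⟨characterOfAlgHom θ (hcont _), v, ?_, hv, fun a => rfl⟩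
  ext i
  change inner ℂ v (creationOp n i (vacuum n)) = z i
  rw [hgen, hvac, mul_one]

/-- The points of the sphere are reached by compactness of the character space. -/
theorem range_discCoords : range (discCoords (n := n)) = closedBall 0 1 := by
  refine Subset.antisymm ?_ ?_
  · rintro _ ⟨θ, rfl⟩
    simpa using norm_discCoords_le_one θ
  · rw [← closure_ball 0 one_ne_zero]
    refine closure_minimal ?_ (isCompact_range continuous_discCoords).isClosed
    intro z hz
    obtain ⟨θ, _, hθ, _⟩ := exists_character_of_norm_lt_one (by simpa using hz : ‖z‖ < 1)
    exact ⟨θ, hθ⟩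

theorem isEmbedding_discCoords : Topology.IsEmbedding (discCoords (n := n)) :=
  (continuous_discCoords.isClosedEmbedding discCoords_injective).isEmbedding

/-! ### Elements of the disc algebra are determined by their values at the vacuum -/

/-- The right creation operator, which appends the word `u`. -/
def appendWord (u : FreeMonoid (Fin n)) : Fock n →ₗᵢ[ℂ] Fock n :=
  (orthonormal_wordVec.comp (fun w : FreeMonoid (Fin n) => w * u)
    (mul_left_injective u)).orthogonalFamily.linearIsometry

theorem appendWord_wordVec (u w : FreeMonoid (Fin n)) :
    appendWord u (wordVec w) = wordVec (w * u) := by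
  classical
  have : wordVec w = lp.single 2 w (1 : ℂ) := by rw [wordVec]
  rw [this, appendWord, OrthogonalFamily.linearIsometry_apply_single]
  simp

theorem ext_wordVec {A B : Fock n →L[ℂ] Fock n} (h : ∀ w, A (wordVec w) = B (wordVec w)) :
    A = B := by
  classical
  refine lp.ext_continuousLinearMap (by norm_num) fun w => ?_
  ext1
  have : wordVec w = lp.single 2 w (1 : ℂ) := by rw [wordVec]
  simpa [this] using h w

theorem commute_appendWord (u : FreeMonoid (Fin n)) (a : discAlgebra n) (f : Fock n) :
    (a : Fock n →L[ℂ] Fock n) (appendWord u f) = appendWord u ((a : Fock n →L[ℂ] Fock n) f) := by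
  have hle : discAlgebra n ≤
      Subalgebra.centralizer ℂ {(appendWord u : Fock n →ₗᵢ[ℂ] Fock n).toContinuousLinearMap} := by
    refine Subalgebra.topologicalClosure_minimal (Algebra.adjoin_le ?_)
      (Set.isClosed_centralizer _)
    rintro _ ⟨i, rfl⟩
    rw [SetLike.mem_coe, Subalgebra.mem_centralizer_iff]
    rintro _ rfl
    refine ext_wordVec fun w => ?_
    change appendWord u (creationOp n i (wordVec w)) = creationOp n i (appendWord u (wordVec w))
    rw [creationOp_wordVec, appendWord_wordVec, appendWord_wordVec, creationOp_wordVec, mul_assoc]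
  have h := Subalgebra.mem_centralizer_iff ℂ |>.1 (hle a.2) _ rfl
  exact (congrArg (fun B : Fock n →L[ℂ] Fock n => B f) h).symm

/-- The vacuum is separating: it is cyclic for the right creation operators, which commute with the
disc algebra. -/
theorem eq_of_apply_vacuum_eq {a b : discAlgebra n}
    (h : (a : Fock n →L[ℂ] Fock n) (vacuum n) = (b : Fock n →L[ℂ] Fock n) (vacuum n)) : a = b := by
  refine Subtype.ext (ext_wordVec fun w => ?_)
  have hw : wordVec w = appendWord w (vacuum n) := by
    rw [vacuum, appendWord_wordVec, one_mul]
  rw [hw, commute_appendWord, commute_appendWord, h]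

/-- A contraction in the disc algebra that has the same values as `S i` at the characters of the
open ball is `S i`: its first Fourier coefficient at `i` is `1`, which leaves no room for others. -/
theorem eq_discGen_of_forall_character {a : discAlgebra n} (ha : ‖a‖ ≤ 1) {i : Fin n}
    (h : ∀ θ : WeakDual.characterSpace ℂ (discAlgebra n), ‖discCoords θ‖ < 1 →
      θ a = θ (discGen n i)) : a = discGen n i := by
  set f : Fock n := (a : Fock n →L[ℂ] Fock n) (vacuum n) with hf
  set e : Fock n := creationOp n i (vacuum n) with he
  have hvac1 : ‖vacuum n‖ = 1 := norm_wordVec 1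
  have hf1 : ‖f‖ ≤ 1 := by
    refine ((a : Fock n →L[ℂ] Fock n).le_opNorm _).trans ?_
    rw [hvac1, mul_one]
    exact ha
  have he1 : ‖e‖ = 1 := by rw [he, ← hvac1]; exact (creationIsometry n i).norm_map _
  have hf0 : inner ℂ (vacuum n) f = 0 := by
    obtain ⟨θ, v, hθ, hv, hva⟩ :=
      exists_character_of_norm_lt_one (n := n) (z := 0) (by simp)
    have hv' : v = vacuum n := by simpa using hv
    have hθa : θ a = inner ℂ (vacuum n) f := by rw [hva, hv']
    rw [← hθa, h θ (by simp [hθ]), ← discCoords_apply, hθ]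
    rfl
  -- Compare the values at the point `t e_i`, for small `t > 0`, up to first order.
  have key (t : ℝ) (ht0 : 0 < t) (ht : t ≤ 1 / 2) : ‖inner ℂ e f - 1‖ ≤ 2 * t := by
    have htn : ‖(t : ℂ)‖ = t := by rw [Complex.norm_real, Real.norm_of_nonneg ht0.le]
    have hzn : ‖EuclideanSpace.single i (t : ℂ)‖ = t := by simp [ht0.le]
    obtain ⟨θ, v, hθ, hv, hva⟩ :=
      exists_character_of_norm_lt_one (n := n) (z := EuclideanSpace.single i (t : ℂ))
        (by rw [hzn]; linarith)
    have hv1 : v = vacuum n + (t : ℂ) • creationOp n i v := by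
      conv_lhs => rw [hv]
      rw [Finset.sum_eq_single i]
      · simp
      · intro j _ hj
        simp [hj]
      · simp
    have hSn (g : Fock n) : ‖creationOp n i g‖ = ‖g‖ := (creationIsometry n i).norm_map g
    have hvn : ‖v‖ ≤ 2 := by
      have h1 : ‖v‖ ≤ 1 + t * ‖v‖ := by
        conv_lhs => rw [hv1]
        refine (norm_add_le _ _).trans ?_
        rw [hvac1, norm_smul, htn, hSn]
      nlinarith [norm_nonneg v]
    have hv2 : v = vacuum n + (t : ℂ) • e + ((t : ℂ) ^ 2) • creationOp n i (creationOp n i v) := by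
      conv_lhs => rw [hv1, hv1]
      rw [map_add, map_smul, smul_add, smul_smul, ← sq, add_assoc]
    have hθa : θ a = t := by
      rw [h θ (by rw [hθ, hzn]; linarith), ← discCoords_apply, hθ]
      simp
    have hexp : (t : ℂ) * (inner ℂ e f - 1) =
        -((t : ℂ) ^ 2 * inner ℂ (creationOp n i (creationOp n i v)) f) := by
      have h1 := hva a
      rw [hθa, ← hf, hv2, inner_add_left, inner_add_left, inner_smul_left, inner_smul_left, hf0,
        map_pow, Complex.conj_ofReal] at h1
      linear_combination (-1 : ℂ) * h1
    have hb : ‖inner ℂ (creationOp n i (creationOp n i v)) f‖ ≤ 2 := by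
      refine (norm_inner_le_norm _ _).trans ?_
      rw [hSn, hSn]
      nlinarith [norm_nonneg v, norm_nonneg f]
    have hn := congrArg norm hexp
    rw [norm_neg, norm_mul, norm_mul, norm_pow, htn] at hn
    have : t * ‖inner ℂ e f - 1‖ ≤ t * (2 * t) := by rw [hn]; nlinarith
    exact le_of_mul_le_mul_left this ht0
  have hef : inner ℂ e f = 1 := by
    rw [← sub_eq_zero, ← norm_le_zero_iff]
    refine le_of_forall_pos_le_add fun ε hε => ?_
    rw [zero_add]
    refine (key (min (1 / 2) (ε / 2)) (by positivity) (min_le_left _ _)).trans ?_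
    linarith [min_le_right (1 / 2) (ε / 2)]
  have hfe : f = e := by
    have h1 := norm_sub_sq (𝕜 := ℂ) e f
    rw [hef, he1] at h1
    simp only [RCLike.re_to_complex, one_re] at h1
    have h2 : ‖e - f‖ ^ 2 ≤ 0 := by nlinarith [norm_nonneg f]
    have h3 : ‖e - f‖ = 0 :=
      pow_eq_zero_iff two_ne_zero |>.1 (le_antisymm h2 (sq_nonneg _))
    exact (sub_eq_zero.1 (norm_eq_zero.1 h3)).symm
  exact eq_of_apply_vacuum_eq hfe

theorem norm_map_of_isometry {φ : discAlgebra n ≃ₐ[ℂ] discAlgebra n} (hφ : Isometry φ)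
    (a : discAlgebra n) : ‖φ a‖ = ‖a‖ := by
  have := hφ.dist_eq a 0
  rwa [map_zero, dist_zero_right, dist_zero_right] at this

/-- An isometric automorphism that fixes the characters of the open ball is the identity, although
for `n ≥ 2` these characters do not separate the elements of the disc algebra. -/
theorem eq_refl_of_forall_character {φ : discAlgebra n ≃ₐ[ℂ] discAlgebra n} (hφ : Isometry φ)
    (h : ∀ θ : WeakDual.characterSpace ℂ (discAlgebra n), ‖discCoords θ‖ < 1 →
      ∀ a, θ (φ a) = θ a) : φ = AlgEquiv.refl := by
  ext1 a
  induction a using discAlgebra_induction with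
  | hgen i =>
    refine eq_discGen_of_forall_character ?_ fun θ hθ => h θ hθ _
    rw [norm_map_of_isometry hφ]
    exact (creationIsometry n i).norm_toContinuousLinearMap_le
  | hscalar c => rw [AlgEquiv.commutes, AlgEquiv.commutes]
  | hadd a b ha hb => rw [map_add, ha, hb]; rfl
  | hmul a b ha hb => rw [map_mul, ha, hb]; rfl
  | hclosed => exact isClosed_eq hφ.continuous continuous_id

end Fock

/-! ### Characters are completely contractive -/

theorem matrixOperator_apply {H : Type*} [NormedAddCommGroup H] [InnerProductSpace ℂ H] {k : ℕ}
    (M : Matrix (Fin k) (Fin k) (H →L[ℂ] H)) (x : PiLp 2 (fun _ : Fin k => H)) (i : Fin k) :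
    matrixOperator M x i = ∑ j, M i j (x j) := by
  simp [matrixOperator]

section

variable {n : ℕ}

/-- A linear combination of the entries of an operator matrix is controlled by the norm of the
matrix. -/
theorem norm_sum_sum_smul_le {k : ℕ} (M : Matrix (Fin k) (Fin k) (discAlgebra n))
    (x y : EuclideanSpace ℂ (Fin k)) :
    ‖∑ i, ∑ j, (y i * x j) • M i j‖ ≤
      ‖y‖ * ‖x‖ * ‖matrixOperator (M.map (discAlgebra n).val)‖ := by
  set T := matrixOperator (M.map (discAlgebra n).val) with hT
  refine ContinuousLinearMap.opNorm_le_bound _ (by positivity) fun f => ?_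
  set X : PiLp 2 (fun _ : Fin k => Fock n) := WithLp.toLp 2 fun j => x j • f with hX
  have hXn : ‖X‖ = ‖x‖ * ‖f‖ := by
    have : ‖X‖ ^ 2 = (‖x‖ * ‖f‖) ^ 2 := by
      rw [PiLp.norm_sq_eq_of_L2, mul_pow, EuclideanSpace.norm_sq_eq, Finset.sum_mul]
      refine Finset.sum_congr rfl fun j _ => ?_
      rw [← mul_pow, ← norm_smul]
    exact (sq_eq_sq₀ (norm_nonneg _) (by positivity)).1 this
  have hval : ((∑ i, ∑ j, (y i * x j) • M i j : discAlgebra n) : Fock n →L[ℂ] Fock n) f =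
      ∑ i, y i • T X i := by
    rw [AddSubmonoidClass.coe_finsetSum, sum_apply]
    refine Finset.sum_congr rfl fun i _ => ?_
    rw [AddSubmonoidClass.coe_finsetSum, sum_apply, hT, matrixOperator_apply, Finset.smul_sum]
    refine Finset.sum_congr rfl fun j _ => ?_
    change (y i * x j) • (M i j : Fock n →L[ℂ] Fock n) f =
      y i • (M i j : Fock n →L[ℂ] Fock n) (x j • f)
    rw [map_smul, smul_smul]
  refine (congrArg norm hval).trans_le ?_
  calc ‖∑ i, y i • T X i‖ ≤ ∑ i, ‖y i‖ * ‖T X i‖ :=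
        (norm_sum_le _ _).trans (Finset.sum_le_sum fun i _ => (norm_smul_le _ _))
    _ ≤ √(∑ i, ‖y i‖ ^ 2) * √(∑ i, ‖T X i‖ ^ 2) := Real.sum_mul_le_sqrt_mul_sqrt _ _ _
    _ = ‖y‖ * ‖T X‖ := by rw [← EuclideanSpace.norm_eq, ← PiLp.norm_eq_of_L2]
    _ ≤ ‖y‖ * (‖T‖ * ‖X‖) := by gcongr; exact T.le_opNorm X
    _ = ‖y‖ * ‖x‖ * ‖T‖ * ‖f‖ := by rw [hXn]; ring

/-- A character of the noncommutative disc algebra as a representation on `ℂ`. -/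
def scalarRep (θ : WeakDual.characterSpace ℂ (discAlgebra n)) :
    discAlgebra n →ₐ[ℂ] (ℂ →L[ℂ] ℂ) :=
  (Algebra.ofId ℂ (ℂ →L[ℂ] ℂ)).comp (AlgHomClass.toAlgHom θ)

theorem scalarRep_apply (θ : WeakDual.characterSpace ℂ (discAlgebra n)) (a : discAlgebra n) :
    scalarRep θ a = algebraMap ℂ (ℂ →L[ℂ] ℂ) (θ a) := rfl

/-- With `y = θ(M) x`, the scalar `‖y‖ ^ 2` is the value of `θ` at `∑ conj (y i) x j M i j`. -/
theorem isCompletelyContractive_scalarRep (θ : WeakDual.characterSpace ℂ (discAlgebra n)) :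
    IsCompletelyContractive (scalarRep θ) := by
  intro k M
  refine ContinuousLinearMap.opNorm_le_bound _ (norm_nonneg _) fun x => ?_
  set y : EuclideanSpace ℂ (Fin k) := matrixOperator (M.map (scalarRep θ)) x with hy
  have hyi (i : Fin k) : y i = ∑ j, θ (M i j) * x j := by
    rw [hy, matrixOperator_apply]
    rfl
  set y' : EuclideanSpace ℂ (Fin k) := WithLp.toLp 2 fun i => conj (y i) with hy'
  have hyn : ‖y'‖ = ‖y‖ := by simp [EuclideanSpace.norm_eq, hy']
  have hθ : θ (∑ i, ∑ j, (y' i * x j) • M i j) = ((‖y‖ ^ 2 : ℝ) : ℂ) := by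
    rw [EuclideanSpace.norm_sq_eq, map_sum, Complex.ofReal_sum]
    refine Finset.sum_congr rfl fun i _ => ?_
    have h1 : θ (∑ j, (y' i * x j) • M i j) = conj (y i) * y i := by
      rw [map_sum, hyi, Finset.mul_sum]
      refine Finset.sum_congr rfl fun j _ => ?_
      rw [map_smul, smul_eq_mul, ← hyi]
      change conj (y i) * x j * _ = _
      ring
    rw [h1, Complex.conj_mul']
    push_cast
    rfl
  have h := (norm_discCharacter_apply_le θ _).trans (norm_sum_sum_smul_le M x y')
  rw [hθ, hyn, Complex.norm_real, Real.norm_of_nonneg (sq_nonneg _)] at h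
  by_cases h0 : ‖y‖ = 0
  · rw [h0]; positivity
  · have hpos : 0 < ‖y‖ := lt_of_le_of_ne (norm_nonneg _) (Ne.symm h0)
    refine le_of_mul_le_mul_left ?_ hpos
    linarith

end

/-! ### Characters of the semicrossed product -/

section SemicrossedProduct

variable {n : ℕ} {φ : discAlgebra n ≃ₐ[ℂ] discAlgebra n}

instance : NormedAlgebra ℂ (SemicrossedProduct φ) where
  norm_smul_le := norm_smul_le

instance : CompactSpace (WeakDual.characterSpace ℂ (SemicrossedProduct φ)) :=
  compactSpace_characterSpace

/-- Polynomials that agree in all covariant representations agree in the semicrossed product. -/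
theorem toCompletion_eq_of_eval_eq {p q : Poly φ} (h : ∀ ρ : CovariantRep φ, ρ.eval p = ρ.eval q) :
    Poly.toCompletion φ p = Poly.toCompletion φ q := by
  rw [← sub_eq_zero, ← map_sub, ← norm_eq_zero]
  refine (UniformSpace.Completion.norm_coe (p - q)).trans ?_
  change universalNorm (p - q) = 0
  have : ∀ ρ : CovariantRep φ, ‖ρ.eval (p - q)‖ = 0 := fun ρ => by
    rw [map_sub, h ρ, sub_self, norm_zero]
  rw [universalNorm]
  simp only [this]
  exact Real.iSup_const_zero

theorem norm_toCompletion_le {p : Poly φ} {C : ℝ} (hC : 0 ≤ C)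
    (h : ∀ ρ : CovariantRep φ, ‖ρ.eval p‖ ≤ C) : ‖Poly.toCompletion φ p‖ ≤ C :=
  (UniformSpace.Completion.norm_coe p).trans_le (Real.iSup_le h hC)

variable (φ) in
/-- The embedding of the noncommutative disc algebra as an algebra homomorphism. -/
def coeffHom : discAlgebra n →ₐ[ℂ] SemicrossedProduct φ where
  toFun := coeff φ
  map_one' := (toCompletion_eq_of_eval_eq fun ρ => by
    rw [ρ.eval_coeff, map_one, map_one]).trans (map_one (Poly.toCompletion φ))
  map_mul' a b := (toCompletion_eq_of_eval_eq fun ρ => by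
    rw [ρ.eval_coeff, map_mul, map_mul, ρ.eval_coeff, ρ.eval_coeff]).trans
      (map_mul (Poly.toCompletion φ) _ _)
  map_zero' := (toCompletion_eq_of_eval_eq fun ρ => by
    rw [ρ.eval_coeff, map_zero, map_zero]).trans (map_zero (Poly.toCompletion φ))
  map_add' a b := (toCompletion_eq_of_eval_eq fun ρ => by
    rw [ρ.eval_coeff, map_add, map_add, ρ.eval_coeff, ρ.eval_coeff]).trans
      (map_add (Poly.toCompletion φ) _ _)
  commutes' c := toCompletion_eq_of_eval_eq (q := algebraMap ℂ (Poly φ) c) fun ρ => by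
    rw [ρ.eval_coeff, AlgHom.commutes, AlgHom.commutes]

theorem coeffHom_apply (a : discAlgebra n) : coeffHom φ a = coeff φ a := rfl

theorem norm_coeff_le (a : discAlgebra n) : ‖coeff φ a‖ ≤ ‖a‖ :=
  norm_toCompletion_le (norm_nonneg a) fun ρ => by
    rw [ρ.eval_coeff]
    exact ρ.completelyContractive.norm_le a

theorem norm_shift_le : ‖shift φ‖ ≤ 1 :=
  norm_toCompletion_le zero_le_one fun ρ => by
    rw [ρ.eval_shift]
    exact ρ.norm_le_one

theorem norm_one_semicrossedProduct_le : ‖(1 : SemicrossedProduct φ)‖ ≤ 1 := by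
  rw [← map_one (Poly.toCompletion φ)]
  refine norm_toCompletion_le zero_le_one fun ρ => ?_
  rw [map_one]
  exact ContinuousLinearMap.norm_id_le

theorem coeff_mul_shift (a : discAlgebra n) :
    coeff φ a * shift φ = shift φ * coeff φ (φ a) := by
  rw [coeff, shift, coeff, ← map_mul, ← map_mul]
  refine toCompletion_eq_of_eval_eq fun ρ => ?_
  rw [map_mul, map_mul, ρ.eval_coeff, ρ.eval_shift, ρ.eval_coeff, ρ.covariant]

theorem continuous_coeffHom : Continuous (coeffHom φ) :=
  AddMonoidHomClass.continuous_of_bound (coeffHom φ) 1 fun a => by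
    rw [one_mul]
    exact norm_coeff_le a

/-- Closed properties that are stable under the algebra operations hold on the semicrossed product
as soon as they hold for its generators. -/
theorem semicrossedProduct_induction {P : SemicrossedProduct φ → Prop}
    (hcoeff : ∀ a, P (coeff φ a)) (hshift : P (shift φ))
    (hadd : ∀ a b, P a → P b → P (a + b))
    (hmul : ∀ a b, P a → P b → P (a * b)) (hclosed : IsClosed {a | P a})
    (a : SemicrossedProduct φ) : P a := by
  induction a using UniformSpace.Completion.induction_on with
  | hp => exact hclosed
  | ih p =>
    change P (Poly.toCompletion φ p)
    induction p using FreeAlgebra.induction with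
    | grade0 c =>
      have := hcoeff (algebraMap ℂ _ c)
      rwa [← coeffHom_apply, AlgHom.commutes] at this
    | grade1 g =>
      cases g with
      | coeff a => exact hcoeff a
      | shift => exact hshift
    | mul p q hp hq => exact (map_mul (Poly.toCompletion φ) p q) ▸ hmul _ _ hp hq
    | add p q hp hq => exact (map_add (Poly.toCompletion φ) p q) ▸ hadd _ _ hp hq

/-- The restriction of a character to the noncommutative disc algebra. -/
def restrictCharacter (θ : WeakDual.characterSpace ℂ (SemicrossedProduct φ)) :
    WeakDual.characterSpace ℂ (discAlgebra n) :=
  characterOfAlgHom ((AlgHomClass.toAlgHom θ : SemicrossedProduct φ →ₐ[ℂ] ℂ).comp (coeffHom φ))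
    ((map_continuous θ).comp continuous_coeffHom)

theorem restrictCharacter_apply (θ : WeakDual.characterSpace ℂ (SemicrossedProduct φ))
    (a : discAlgebra n) : restrictCharacter θ a = θ (coeff φ a) := rfl

theorem coords_eq (θ : WeakDual.characterSpace ℂ (SemicrossedProduct φ)) :
    coords φ θ = (discCoords (restrictCharacter θ), θ (shift φ)) := rfl

theorem norm_character_shift_le (θ : WeakDual.characterSpace ℂ (SemicrossedProduct φ)) :
    ‖θ (shift φ)‖ ≤ 1 :=
  (norm_character_apply_le θ _).trans
    (mul_le_one₀ norm_shift_le (norm_nonneg _) norm_one_semicrossedProduct_le)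

theorem coords_injective : Function.Injective (coords φ) := by
  intro θ₁ θ₂ h
  rw [coords_eq, coords_eq, Prod.mk.injEq] at h
  have h1 := discCoords_injective h.1
  ext a
  induction a using semicrossedProduct_induction with
  | hcoeff a => rw [← restrictCharacter_apply, h1, restrictCharacter_apply]
  | hshift => exact h.2
  | hadd a b ha hb => rw [map_add, map_add, ha, hb]
  | hmul a b ha hb => rw [map_mul, map_mul, ha, hb]
  | hclosed => exact isClosed_eq (map_continuous θ₁) (map_continuous θ₂)

theorem continuous_coords : Continuous (coords φ) :=
  ((PiLp.continuous_toLp 2 _).comp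
    (continuous_pi fun i => continuous_character_apply (coeff φ (discGen n i)))).prodMk
      (continuous_character_apply (shift φ))

theorem isEmbedding_coords : Topology.IsEmbedding (coords φ) :=
  (continuous_coords.isClosedEmbedding coords_injective).isEmbedding

theorem mem_fixSet_iff (θ : WeakDual.characterSpace ℂ (discAlgebra n)) :
    discCoords θ ∈ fixSet φ ↔ ∀ a, θ (φ a) = θ a := by
  constructor
  · rintro ⟨θ', h1, h2⟩
    have : θ' = θ := character_ext fun i => h1 i
    exact this ▸ h2
  · exact fun h => ⟨θ, fun i => rfl, h⟩

theorem norm_le_one_of_mem_fixSet {z : EuclideanSpace ℂ (Fin n)} (hz : z ∈ fixSet φ) :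
    ‖z‖ ≤ 1 := by
  obtain ⟨θ, h1, _⟩ := hz
  have : discCoords θ = z := by ext i; exact h1 i
  exact this ▸ norm_discCoords_le_one θ

/-- The one-dimensional covariant representation given by a character `θ` and a scalar `μ`. -/
def scalarCovariantRep (θ : WeakDual.characterSpace ℂ (discAlgebra n)) (μ : ℂ) (hμ : ‖μ‖ ≤ 1)
    (h : ∀ a, θ a * μ = μ * θ (φ a)) : CovariantRep φ where
  H := ℂ
  π := scalarRep θ
  K := algebraMap ℂ (ℂ →L[ℂ] ℂ) μ
  completelyContractive := isCompletelyContractive_scalarRep θ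
  norm_le_one := by
    refine ContinuousLinearMap.opNorm_le_bound _ zero_le_one fun x => ?_
    rw [ContinuousLinearMap.algebraMap_apply, norm_smul]
    gcongr
  covariant a := by rw [scalarRep_apply, scalarRep_apply, ← map_mul, h, map_mul]

/-- Evaluation at `1`, which identifies the operators on `ℂ` with the scalars. -/
def evalOne : (ℂ →L[ℂ] ℂ) →ₐ[ℂ] ℂ :=
  AlgHom.ofLinearMap (ContinuousLinearMap.apply ℂ ℂ (1 : ℂ)).toLinearMap rfl fun S T => by
    change S (T 1) = S 1 * T 1
    rw [← mul_one (T 1), ← smul_eq_mul (T 1), map_smul, smul_eq_mul, smul_eq_mul, mul_one, mul_comm]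

theorem exists_character (θ : WeakDual.characterSpace ℂ (discAlgebra n)) (μ : ℂ) (hμ : ‖μ‖ ≤ 1)
    (h : ∀ a, θ a * μ = μ * θ (φ a)) :
    ∃ Θ : WeakDual.characterSpace ℂ (SemicrossedProduct φ), coords φ Θ = (discCoords θ, μ) := by
  let ρ : CovariantRep φ := scalarCovariantRep θ μ hμ h
  let χ : Poly φ →ₐ[ℂ] ℂ := evalOne.comp (show Poly φ →ₐ[ℂ] (ℂ →L[ℂ] ℂ) from ρ.eval)
  have hχb (p : Poly φ) : ‖χ p‖ ≤ 1 * ‖p‖ := by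
    have h1 : ‖(show ℂ →L[ℂ] ℂ from ρ.eval p) 1‖ ≤ ‖ρ.eval p‖ * ‖(1 : ℂ)‖ :=
      ContinuousLinearMap.le_opNorm _ _
    rw [norm_one, mul_one] at h1
    rw [one_mul]
    exact h1.trans (norm_eval_le ρ p)
  have hχ : Continuous χ := AddMonoidHomClass.continuous_of_bound χ 1 hχb
  let X : SemicrossedProduct φ →+* ℂ :=
    UniformSpace.Completion.extensionHom (χ : Poly φ →+* ℂ) hχ
  have hX (p : Poly φ) : X (Poly.toCompletion φ p) = χ p :=
    UniformSpace.Completion.extensionHom_coe (χ : Poly φ →+* ℂ) hχ p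
  have hXc : Continuous X := UniformSpace.Completion.continuous_extension
  let Y : SemicrossedProduct φ →ₐ[ℂ] ℂ :=
    { X with commutes' := fun c => (hX (algebraMap ℂ (Poly φ) c)).trans (χ.commutes c) }
  refine ⟨characterOfAlgHom Y hXc, ?_⟩
  have hcoeff (a : discAlgebra n) : χ (Poly.gen φ (Gen.coeff a)) = θ a := by
    change evalOne (ρ.eval (Poly.gen φ (Gen.coeff a))) = θ a
    rw [ρ.eval_coeff]
    exact mul_one (θ a)
  have hshift : χ (Poly.gen φ Gen.shift) = μ := by
    change evalOne (ρ.eval (Poly.gen φ Gen.shift)) = μ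
    rw [ρ.eval_shift]
    exact mul_one μ
  refine Prod.ext ?_ ((hX _).trans hshift)
  ext i
  exact (hX _).trans (hcoeff _)

/-- Where `θ(U) ≠ 0`, the relation `θ(A) θ(U) = θ(U) θ(φ(A))` makes the restriction of `θ` fixed. -/
theorem range_coords : range (coords φ) =
    (closedBall 0 1 ×ˢ {0}) ∪ (fixSet φ ×ˢ closedBall 0 1) := by
  ext ⟨z, μ⟩
  simp only [mem_range, mem_union, mem_prod, mem_closedBall_zero_iff, mem_singleton_iff]
  constructor
  · rintro ⟨Θ, hΘ⟩
    rw [coords_eq, Prod.mk.injEq] at hΘ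
    obtain ⟨rfl, rfl⟩ := hΘ
    by_cases h0 : Θ (shift φ) = 0
    · exact Or.inl ⟨norm_discCoords_le_one _, h0⟩
    · refine Or.inr ⟨(mem_fixSet_iff _).2 fun a => ?_, norm_character_shift_le Θ⟩
      have h := congrArg Θ (coeff_mul_shift (φ := φ) a)
      rw [map_mul, map_mul, mul_comm] at h
      exact (mul_left_cancel₀ h0 h).symm
  · rintro (⟨hz, rfl⟩ | ⟨hz, hμ⟩)
    · obtain ⟨θ, rfl⟩ : z ∈ range discCoords := by rw [range_discCoords]; simpa using hz
      exact exists_character θ 0 (by simp) (by simp)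
    · obtain ⟨θ, rfl⟩ : z ∈ range discCoords := by
        rw [range_discCoords]; simpa using norm_le_one_of_mem_fixSet hz
      exact exists_character θ μ hμ fun a => by rw [(mem_fixSet_iff θ).1 hz, mul_comm]

end SemicrossedProduct

section Holomorphy

variable {n : ℕ} {φ : discAlgebra n ≃ₐ[ℂ] discAlgebra n} {E : Type*} [NormedAddCommGroup E]
  [NormedSpace ℂ E] {Ω : Set E}

/-! ### Holomorphic families of characters -/

theorem differentiableOn_discCharacter_apply (hΩ : IsOpen Ω)
    {h : E → WeakDual.characterSpace ℂ (discAlgebra n)}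
    (hd : DifferentiableOn ℂ (fun w => discCoords (h w)) Ω) (a : discAlgebra n) :
    DifferentiableOn ℂ (fun w => h w a) Ω := by
  induction a using discAlgebra_induction with
  | hgen i => exact differentiableOn_euclidean.1 hd i
  | hscalar c =>
    simp only [AlgHomClass.commutes]
    exact differentiableOn_const _
  | hadd a b ha hb =>
    simp only [map_add]
    exact ha.add hb
  | hmul a b ha hb =>
    simp only [map_mul]
    exact ha.mul hb
  | hclosed => exact isClosed_setOf_differentiableOn hΩ h

theorem differentiableOn_character_apply (hΩ : IsOpen Ω)
    {h : E → WeakDual.characterSpace ℂ (SemicrossedProduct φ)}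
    (hd : DifferentiableOn ℂ (fun w => coords φ (h w)) Ω) (a : SemicrossedProduct φ) :
    DifferentiableOn ℂ (fun w => h w a) Ω := by
  induction a using semicrossedProduct_induction with
  | hcoeff a =>
    exact differentiableOn_discCharacter_apply (h := fun w => restrictCharacter (h w)) hΩ hd.fst a
  | hshift => exact hd.snd
  | hadd a b ha hb =>
    simp only [map_add]
    exact ha.add hb
  | hmul a b ha hb =>
    simp only [map_mul]
    exact ha.mul hb
  | hclosed => exact isClosed_setOf_differentiableOn hΩ h

end Holomorphy

/-! ### The action of an automorphism on the ball -/

section Action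

variable {n : ℕ}

instance : Nonempty (WeakDual.characterSpace ℂ (discAlgebra n)) :=
  let ⟨θ, _⟩ := exists_character_of_norm_lt_one (n := n) (z := 0) (by simp)
  ⟨θ⟩

/-- The character of the noncommutative disc algebra at a point of the closed unit ball; a junk
value at the other points. -/
def discCharacter (z : EuclideanSpace ℂ (Fin n)) : WeakDual.characterSpace ℂ (discAlgebra n) :=
  Function.invFun discCoords z

theorem discCoords_discCharacter {z : EuclideanSpace ℂ (Fin n)} (hz : ‖z‖ ≤ 1) :
    discCoords (discCharacter z) = z :=
  Function.invFun_eq (f := discCoords) <| by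
    have : z ∈ range discCoords := by rw [range_discCoords]; simpa using hz
    exact this

theorem continuousOn_discCharacter :
    ContinuousOn (discCharacter (n := n)) (closedBall 0 1) := by
  rw [isEmbedding_discCoords.isInducing.continuousOn_iff]
  exact continuousOn_id.congr fun z hz => discCoords_discCharacter (by simpa using hz)

theorem differentiableOn_discCharacter (a : discAlgebra n) :
    DifferentiableOn ℂ (fun z => discCharacter z a) (ball 0 1) :=
  differentiableOn_discCharacter_apply isOpen_ball
    (differentiableOn_id.congr fun _ hz =>
      discCoords_discCharacter (mem_ball_zero_iff.1 hz).le) a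

variable {φ : discAlgebra n ≃ₐ[ℂ] discAlgebra n}

variable (φ) in
/-- The map that `φ` induces on the closed unit ball by composition with characters. -/
def ballMap (z : EuclideanSpace ℂ (Fin n)) : EuclideanSpace ℂ (Fin n) :=
  WithLp.toLp 2 fun i => discCharacter z (φ (discGen n i))

/-- The composition of a character with a continuous automorphism. -/
def compCharacter (hφ : Continuous φ) (θ : WeakDual.characterSpace ℂ (discAlgebra n)) :
    WeakDual.characterSpace ℂ (discAlgebra n) :=
  characterOfAlgHom ((AlgHomClass.toAlgHom θ : discAlgebra n →ₐ[ℂ] ℂ).comp φ.toAlgHom)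
    ((map_continuous θ).comp hφ)

theorem compCharacter_apply (hφ : Continuous φ) (θ : WeakDual.characterSpace ℂ (discAlgebra n))
    (a : discAlgebra n) : compCharacter hφ θ a = θ (φ a) := rfl

theorem ballMap_eq (hφ : Continuous φ) (z : EuclideanSpace ℂ (Fin n)) :
    ballMap φ z = discCoords (compCharacter hφ (discCharacter z)) := rfl

theorem mapsTo_ballMap (hφ : Continuous φ) :
    MapsTo (ballMap φ) (closedBall 0 1) (closedBall 0 1) := fun z _ => by
  rw [ballMap_eq hφ, mem_closedBall_zero_iff]
  exact norm_discCoords_le_one _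

theorem differentiableOn_ballMap : DifferentiableOn ℂ (ballMap φ) (ball 0 1) :=
  differentiableOn_euclidean.2 fun i => differentiableOn_discCharacter (φ (discGen n i))

theorem continuousOn_ballMap : ContinuousOn (ballMap φ) (closedBall 0 1) :=
  (PiLp.continuous_toLp 2 _).comp_continuousOn <| continuousOn_pi.2 fun i =>
    (continuous_character_apply (φ (discGen n i))).comp_continuousOn continuousOn_discCharacter

theorem ballMap_eq_self_iff (hφ : Continuous φ) {z : EuclideanSpace ℂ (Fin n)} (hz : ‖z‖ ≤ 1) :
    ballMap φ z = z ↔ z ∈ fixSet φ := by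
  obtain ⟨θ, rfl⟩ : ∃ θ, discCoords θ = z := ⟨_, discCoords_discCharacter hz⟩
  have hθ : discCharacter (discCoords θ) = θ :=
    discCoords_injective (discCoords_discCharacter hz)
  rw [mem_fixSet_iff, ballMap_eq hφ, hθ, discCoords_injective.eq_iff]
  constructor
  · intro h a
    rw [← compCharacter_apply hφ, h]
  · intro h
    ext a
    exact h a

/-- The fixed points in the open ball are the points of an affine subspace. -/
theorem exists_submodule_fixInterior (hφ : Continuous φ) {p : EuclideanSpace ℂ (Fin n)}
    (hp : p ∈ fixInterior φ) :
    ∃ V : Submodule ℂ (EuclideanSpace ℂ (Fin n)),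
      ∀ z, z ∈ fixInterior φ ↔ ‖z‖ < 1 ∧ z - p ∈ V := by
  have hp1 : ‖p‖ < 1 := by simpa using hp.2
  obtain ⟨V, hV⟩ := exists_submodule_fixedPoints differentiableOn_ballMap continuousOn_ballMap
    (mapsTo_ballMap hφ) hp1 ((ballMap_eq_self_iff hφ hp1.le).2 hp.1)
  refine ⟨V, fun z => ?_⟩
  rw [fixInterior, mem_inter_iff, mem_ball_zero_iff, and_comm]
  refine and_congr_right fun hz => ?_
  have := hV (z - p) (by simpa using hz)
  rwa [add_sub_cancel, ballMap_eq_self_iff hφ hz.le] at this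

end Action

/-! ### The list of the maximal analytic sets -/

section Listed

variable {n : ℕ} {φ : discAlgebra n ≃ₐ[ℂ] discAlgebra n}

variable (φ) in
/-- The sets that, in coordinates, are the maximal analytic sets. -/
def IsListed (L : Set (EuclideanSpace ℂ (Fin n) × ℂ)) : Prop :=
  (φ ≠ AlgEquiv.refl ∧ L = ball 0 1 ×ˢ {0}) ∨
  ((fixInterior φ).Nonempty ∧ L = fixInterior φ ×ˢ ball 0 1) ∨
  ((fixInterior φ).Nontrivial ∧ ∃ μ : ℂ, ‖μ‖ = 1 ∧ L = fixInterior φ ×ˢ {μ}) ∨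
  ∃ x ∈ fixBoundary φ, L = {x} ×ˢ ball 0 1

theorem IsListed.subset_range {L : Set (EuclideanSpace ℂ (Fin n) × ℂ)} (hL : IsListed φ L) :
    L ⊆ range (coords φ) := by
  rw [range_coords]
  rcases hL with ⟨_, rfl⟩ | ⟨_, rfl⟩ | ⟨_, μ, hμ, rfl⟩ | ⟨x, hx, rfl⟩
  · exact (Set.prod_mono_left ball_subset_closedBall).trans subset_union_left
  · exact (Set.prod_mono inter_subset_left ball_subset_closedBall).trans subset_union_right
  · refine (Set.prod_mono inter_subset_left ?_).trans subset_union_right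
    simp [hμ]
  · refine (Set.prod_mono ?_ ball_subset_closedBall).trans subset_union_right
    simpa using hx.1

/-- No listed set contains another one. -/
theorem IsListed.eq_of_subset (hφ : Isometry φ) {L L' : Set (EuclideanSpace ℂ (Fin n) × ℂ)}
    (hL : IsListed φ L) (hL' : IsListed φ L') (h : L ⊆ L') : L = L' := by
  have h01 : (0 : ℂ) ∈ ball (0 : ℂ) 1 := by simp
  have hF1 {x : EuclideanSpace ℂ (Fin n)} (hx : x ∈ fixBoundary φ) : ‖x‖ = 1 := by
    simpa using hx.2
  have hF0 {x : EuclideanSpace ℂ (Fin n)} (hx : x ∈ fixInterior φ) : ‖x‖ < 1 := by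
    simpa using hx.2
  rcases hL with ⟨hne, rfl⟩ | ⟨⟨p, hp⟩, rfl⟩ | ⟨hnt, μ, hμ, rfl⟩ | ⟨x, hx, rfl⟩
  · rcases hL' with ⟨_, rfl⟩ | ⟨_, rfl⟩ | ⟨_, μ', hμ', rfl⟩ | ⟨x', hx', rfl⟩
    · rfl
    · refine absurd (eq_refl_of_forall_character hφ fun θ hθ => ?_) hne
      have := h (show (discCoords θ, (0 : ℂ)) ∈ _ from ⟨by simpa using hθ, rfl⟩)
      exact (mem_fixSet_iff θ).1 this.1.1
    · have := (h (show ((0 : EuclideanSpace ℂ (Fin n)), (0 : ℂ)) ∈ _ from ⟨by simp, rfl⟩)).2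
      simp only [mem_singleton_iff] at this
      simp [← this] at hμ'
    · have := (h (show ((0 : EuclideanSpace ℂ (Fin n)), (0 : ℂ)) ∈ _ from ⟨by simp, rfl⟩)).1
      simp only [mem_singleton_iff] at this
      simpa [← this] using hF1 hx'
  · rcases hL' with ⟨_, rfl⟩ | ⟨_, rfl⟩ | ⟨_, μ', hμ', rfl⟩ | ⟨x', hx', rfl⟩
    · have := (h (show (p, (1 / 2 : ℂ)) ∈ _ from ⟨hp, by simp; norm_num⟩)).2
      simp at this
    · rfl
    · have := (h (show (p, (0 : ℂ)) ∈ _ from ⟨hp, h01⟩)).2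
      simp only [mem_singleton_iff] at this
      simp [← this] at hμ'
    · have := (h (show (p, (0 : ℂ)) ∈ _ from ⟨hp, h01⟩)).1
      simp only [mem_singleton_iff] at this
      exact absurd (hF1 hx') (this ▸ (hF0 hp).ne)
  · obtain ⟨p, hp⟩ := hnt.nonempty
    have hmem := h (show (p, μ) ∈ _ from ⟨hp, rfl⟩)
    rcases hL' with ⟨_, rfl⟩ | ⟨_, rfl⟩ | ⟨_, μ', hμ', rfl⟩ | ⟨x', hx', rfl⟩
    · have := hmem.2
      simp only [mem_singleton_iff] at this
      simp [this] at hμ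
    · have := hmem.2
      simp [hμ] at this
    · have := hmem.2
      simp only [mem_singleton_iff] at this
      rw [this]
    · have := hmem.2
      simp [hμ] at this
  · have hmem := h (show (x, (0 : ℂ)) ∈ _ from ⟨rfl, h01⟩)
    rcases hL' with ⟨_, rfl⟩ | ⟨_, rfl⟩ | ⟨_, μ', hμ', rfl⟩ | ⟨x', hx', rfl⟩
    · have := hmem.1
      simp [hF1 hx] at this
    · exact absurd (hF1 hx) (hF0 hmem.1).ne
    · exact absurd (hF1 hx) (hF0 hmem.1).ne
    · have := hmem.1
      simp only [mem_singleton_iff] at this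
      rw [this]

instance : Nonempty (WeakDual.characterSpace ℂ (SemicrossedProduct φ)) :=
  let ⟨Θ, _⟩ := exists_character (φ := φ) (Classical.arbitrary _) 0 (by simp) (by simp)
  ⟨Θ⟩

/-- A holomorphic embedding of a domain in a finite-dimensional space into the character space
shows that its image is analytic. -/
theorem isAnalyticSet_of_param {E : Type*} [NormedAddCommGroup E] [NormedSpace ℂ E]
    [FiniteDimensional ℂ E] (hE : 1 ≤ Module.finrank ℂ E) {C : Set E} (hCo : IsOpen C)
    (hCc : IsConnected C) {g : E → EuclideanSpace ℂ (Fin n) × ℂ} (hgd : Differentiable ℂ g)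
    (hge : Topology.IsEmbedding g) (hgC : g '' C ⊆ range (coords φ))
    {O : Set (WeakDual.characterSpace ℂ (SemicrossedProduct φ))} (hO : coords φ '' O = g '' C) :
    IsAnalyticSet O := by
  let e : EuclideanSpace ℂ (Fin (Module.finrank ℂ E)) ≃L[ℂ] E :=
    ContinuousLinearEquiv.ofFinrankEq finrank_euclideanSpace_fin
  let h : EuclideanSpace ℂ (Fin (Module.finrank ℂ E)) →
      WeakDual.characterSpace ℂ (SemicrossedProduct φ) :=
    fun w => Function.invFun (coords φ) (g (e w))
  have hh : ∀ w ∈ e ⁻¹' C, coords φ (h w) = g (e w) := fun w hw =>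
    Function.invFun_eq (hgC ⟨e w, hw, rfl⟩)
  have hΩo : IsOpen (e ⁻¹' C) := hCo.preimage e.continuous
  refine ⟨Module.finrank ℂ E, e ⁻¹' C, h, hE, hΩo, ?_, ?_, ?_, ?_⟩
  · rw [← e.image_symm_eq_preimage]
    exact hCc.image _ e.symm.continuous.continuousOn
  · rw [← isEmbedding_coords.of_comp_iff]
    have : coords φ ∘ (e ⁻¹' C).domRestrict h = g ∘ e ∘ Subtype.val :=
      funext fun w => hh w w.2
    rw [this]
    exact hge.comp (e.toHomeomorph.isEmbedding.comp .subtypeVal)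
  · apply coords_injective.image_injective
    rw [hO, ← image_comp]
    have : (coords φ ∘ h) '' (e ⁻¹' C) = (g ∘ e) '' (e ⁻¹' C) := image_congr hh
    rw [this, image_comp, image_preimage_eq _ e.surjective]
  · intro a
    refine differentiableOn_character_apply hΩo ?_ a
    exact ((hgd.comp e.differentiable).differentiableOn).congr hh

theorem isEmbedding_prodMk_right {X Y : Type*} [TopologicalSpace X] [TopologicalSpace Y] (y : Y) :
    Topology.IsEmbedding fun x : X => (x, y) :=
  Function.LeftInverse.isEmbedding (f := Prod.fst) (fun _ => rfl) continuous_fst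
    (continuous_id.prodMk continuous_const)

theorem isEmbedding_prodMk_left {X Y : Type*} [TopologicalSpace X] [TopologicalSpace Y] (x : X) :
    Topology.IsEmbedding fun y : Y => (x, y) :=
  Function.LeftInverse.isEmbedding (f := Prod.snd) (fun _ => rfl) continuous_snd
    (continuous_const.prodMk continuous_id)

theorem isEmbedding_add_coe (p : EuclideanSpace ℂ (Fin n))
    (V : Submodule ℂ (EuclideanSpace ℂ (Fin n))) :
    Topology.IsEmbedding fun v : V => p + v :=
  (Homeomorph.addLeft p).isEmbedding.comp .subtypeVal

theorem differentiable_add_coe (p : EuclideanSpace ℂ (Fin n))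
    (V : Submodule ℂ (EuclideanSpace ℂ (Fin n))) :
    Differentiable ℂ fun v : V => p + (v : EuclideanSpace ℂ (Fin n)) :=
  V.subtypeL.differentiable.const_add p

/-- The fixed points in the open ball are parametrized by a convex domain in a linear space. -/
theorem exists_param_fixInterior (hφ : Continuous φ) {p : EuclideanSpace ℂ (Fin n)}
    (hp : p ∈ fixInterior φ) :
    ∃ (V : Submodule ℂ (EuclideanSpace ℂ (Fin n))) (B : Set V), IsOpen B ∧ Convex ℝ B ∧
      B.Nonempty ∧ (fun v : V => p + (v : EuclideanSpace ℂ (Fin n))) '' B = fixInterior φ := by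
  obtain ⟨V, hV⟩ := exists_submodule_fixInterior hφ hp
  refine ⟨V, (fun v : V => p + (v : EuclideanSpace ℂ (Fin n))) ⁻¹' ball 0 1,
    isOpen_ball.preimage (isEmbedding_add_coe p V).continuous, ?_, ⟨0, ?_⟩, ?_⟩
  · have := (convex_ball (-p) 1).linear_preimage (V.subtype.restrictScalars ℝ)
    have hset : (fun v : V => p + (v : EuclideanSpace ℂ (Fin n))) ⁻¹' ball 0 1 =
        V.subtype.restrictScalars ℝ ⁻¹' ball (-p) 1 := by
      ext v
      simp [dist_eq_norm, add_comm]
    rw [hset]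
    exact this
  · simpa using ((hV p).1 hp).1
  · ext z
    constructor
    · rintro ⟨v, hv, rfl⟩
      exact (hV _).2 ⟨mem_ball_zero_iff.1 hv, by simp⟩
    · intro hz
      obtain ⟨hz1, hzV⟩ := (hV z).1 hz
      exact ⟨⟨z - p, hzV⟩, by simpa using hz1, by simp⟩

theorem isAnalyticSet_of_image_eq_ball_prod (hn : 1 ≤ n)
    {O : Set (WeakDual.characterSpace ℂ (SemicrossedProduct φ))}
    (h : coords φ '' O = ball 0 1 ×ˢ {0}) : IsAnalyticSet O := by
  have himg : coords φ '' O = (fun z : EuclideanSpace ℂ (Fin n) => (z, (0 : ℂ))) '' ball 0 1 := by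
    rw [h, prod_singleton]
  exact isAnalyticSet_of_param (by simpa using hn) isOpen_ball
    ((convex_ball _ _).isConnected ⟨0, by simp⟩) (by fun_prop) (isEmbedding_prodMk_right 0)
    (himg ▸ image_subset_range _ _) himg

theorem isAnalyticSet_of_image_eq_fixInterior_prod_ball (hφ : Continuous φ)
    (hne : (fixInterior φ).Nonempty)
    {O : Set (WeakDual.characterSpace ℂ (SemicrossedProduct φ))}
    (h : coords φ '' O = fixInterior φ ×ˢ ball 0 1) : IsAnalyticSet O := by
  obtain ⟨p, hp⟩ := hne
  obtain ⟨V, B, hBo, hBc, hBne, hB⟩ := exists_param_fixInterior hφ hp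
  have himg : coords φ '' O =
      Prod.map (fun v : V => p + (v : EuclideanSpace ℂ (Fin n))) (id : ℂ → ℂ) ''
        (B ×ˢ ball 0 1) := by
    rw [h, prodMap_image_prod, hB, image_id]
  refine isAnalyticSet_of_param (E := V × ℂ) ?_ (hBo.prod isOpen_ball)
    ((hBc.prod (convex_ball _ _)).isConnected (hBne.prod ⟨0, by simp⟩))
    (((differentiable_add_coe p V).comp differentiable_fst).prodMk differentiable_snd)
    ((isEmbedding_add_coe p V).prodMap .id) (himg ▸ image_subset_range _ _) himg
  rw [Module.finrank_prod, Module.finrank_self]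
  exact Nat.le_add_left 1 _

theorem isAnalyticSet_of_image_eq_fixInterior_prod_singleton (hφ : Continuous φ)
    (hnt : (fixInterior φ).Nontrivial) {μ : ℂ}
    {O : Set (WeakDual.characterSpace ℂ (SemicrossedProduct φ))}
    (h : coords φ '' O = fixInterior φ ×ˢ {μ}) : IsAnalyticSet O := by
  obtain ⟨p, hp⟩ := hnt.nonempty
  obtain ⟨V, B, hBo, hBc, hBne, hB⟩ := exists_param_fixInterior hφ hp
  have himg : coords φ '' O =
      (fun v : V => (p + (v : EuclideanSpace ℂ (Fin n)), μ)) '' B := by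
    rw [h, ← hB, prod_singleton, image_image]
  refine isAnalyticSet_of_param (E := V) ?_ hBo (hBc.isConnected hBne)
    ((differentiable_add_coe p V).prodMk (differentiable_const μ))
    ((isEmbedding_prodMk_right μ).comp (isEmbedding_add_coe p V))
    (himg ▸ image_subset_range _ _) himg
  obtain ⟨v, _, w, _, hvw⟩ :=
    Set.nontrivial_of_image (fun v : V => p + (v : EuclideanSpace ℂ (Fin n))) B (by rwa [hB])
  have : Nontrivial V := ⟨⟨v, w, hvw⟩⟩
  exact Module.finrank_pos

theorem isAnalyticSet_of_image_eq_singleton_prod_ball {x : EuclideanSpace ℂ (Fin n)}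
    {O : Set (WeakDual.characterSpace ℂ (SemicrossedProduct φ))}
    (h : coords φ '' O = {x} ×ˢ ball 0 1) : IsAnalyticSet O := by
  have himg : coords φ '' O = (fun ν : ℂ => (x, ν)) '' ball 0 1 := by rw [h, singleton_prod]
  exact isAnalyticSet_of_param (by simp) isOpen_ball
    ((convex_ball _ _).isConnected ⟨0, by simp⟩) (by fun_prop) (isEmbedding_prodMk_left x)
    (himg ▸ image_subset_range _ _) himg

theorem IsListed.isAnalyticSet (hn : 1 ≤ n) (hφ : Isometry φ)
    {O : Set (WeakDual.characterSpace ℂ (SemicrossedProduct φ))}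
    (hL : IsListed φ (coords φ '' O)) : IsAnalyticSet O := by
  rcases hL with ⟨_, h⟩ | ⟨hne, h⟩ | ⟨hnt, μ, _, h⟩ | ⟨x, _, h⟩
  · exact isAnalyticSet_of_image_eq_ball_prod hn h
  · exact isAnalyticSet_of_image_eq_fixInterior_prod_ball hφ.continuous hne h
  · exact isAnalyticSet_of_image_eq_fixInterior_prod_singleton hφ.continuous hnt h
  · exact isAnalyticSet_of_image_eq_singleton_prod_ball h

/-- Every analytic set lies in a listed set. -/
theorem IsAnalyticSet.exists_isListed
    {O : Set (WeakDual.characterSpace ℂ (SemicrossedProduct φ))} (hO : IsAnalyticSet O) :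
    ∃ L, IsListed φ L ∧ coords φ '' O ⊆ L := by
  obtain ⟨k, Ω, h, hk, hΩ, hΩc, hemb, rfl, hd⟩ := hO
  have hinj : InjOn h Ω := injOn_iff_injective.2 hemb.injective
  set Z : EuclideanSpace ℂ (Fin k) → EuclideanSpace ℂ (Fin n) :=
    fun w => discCoords (restrictCharacter (h w))
  have hZd : DifferentiableOn ℂ Z Ω :=
    differentiableOn_euclidean.2 fun i => hd (coeff φ (discGen n i))
  have hsub {A : Set (EuclideanSpace ℂ (Fin n))} {B : Set ℂ} (hA : ∀ w ∈ Ω, Z w ∈ A)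
      (hB : ∀ w ∈ Ω, h w (shift φ) ∈ B) : coords φ '' (h '' Ω) ⊆ A ×ˢ B := by
    rintro _ ⟨_, ⟨w, hw, rfl⟩, rfl⟩
    exact ⟨hA w hw, hB w hw⟩
  -- The domain has two points, so the coordinates are not both constant.
  obtain ⟨w₀, hw₀⟩ := hΩc.nonempty
  have hnontriv : ∃ w₁ ∈ Ω, w₁ ≠ w₀ := by
    have : Nonempty (Fin k) := ⟨⟨0, hk⟩⟩
    have : (𝓝[≠] w₀).NeBot := Module.punctured_nhds_neBot ℂ _ w₀
    obtain ⟨w₁, h1, h2⟩ := ((eventually_nhdsWithin_of_eventually_nhds (hΩ.mem_nhds hw₀)).and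
      (self_mem_nhdsWithin (a := w₀) (s := {w₀}ᶜ))).exists
    exact ⟨w₁, h1, h2⟩
  obtain ⟨w₁, hw₁, hw₁₀⟩ := hnontriv
  have hconst : Z w₁ = Z w₀ → h w₁ (shift φ) = h w₀ (shift φ) → False := fun hZ hs =>
    hw₁₀ (hinj hw₁ hw₀ (coords_injective (Prod.ext hZ hs)))
  have hZdich := forall_eq_or_forall_norm_lt_one hΩ hΩc.isPreconnected hZd
    fun w _ => norm_discCoords_le_one _
  by_cases h0 : ∀ w ∈ Ω, h w (shift φ) = 0
  · have hZball : ∀ w ∈ Ω, ‖Z w‖ < 1 := by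
      rcases hZdich with ⟨c, _, hc⟩ | hlt
      · exact (hconst ((hc w₁ hw₁).trans (hc w₀ hw₀).symm)
          ((h0 w₁ hw₁).trans (h0 w₀ hw₀).symm)).elim
      · exact hlt
    by_cases hφ1 : φ = AlgEquiv.refl
    · have hfix : ∀ w ∈ Ω, Z w ∈ fixInterior φ := fun w hw =>
        ⟨(mem_fixSet_iff _).2 fun a => 
          congrArg (restrictCharacter (h w)) (DFunLike.congr_fun hφ1 a), by simpa using hZball w hw⟩
      exact ⟨_, Or.inr (Or.inl ⟨⟨_, hfix w₀ hw₀⟩, rfl⟩),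
        hsub hfix fun w hw => by simp [h0 w hw]⟩
    · exact ⟨_, Or.inl ⟨hφ1, rfl⟩, hsub (fun w hw => by simpa using hZball w hw) h0⟩
  · -- The covariance relation and the identity theorem: all characters of the set restrict to
    -- fixed characters.
    have hfix : ∀ w ∈ Ω, Z w ∈ fixSet φ := fun w hw => (mem_fixSet_iff _).2 fun a => by
      have hprod : ∀ w ∈ Ω, h w (shift φ) * (h w (coeff φ (φ a)) - h w (coeff φ a)) = 0 :=
        fun w _ => by
          have := congrArg (h w) (coeff_mul_shift (φ := φ) a)
          rw [map_mul, map_mul] at this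
          rw [mul_sub, ← this]
          ring
      rcases eqOn_zero_or_eqOn_zero_of_mul hΩ hΩc.isPreconnected (hd (shift φ))
        ((hd (coeff φ (φ a))).sub (hd (coeff φ a))) hprod with h1 | h1
      · exact absurd h1 h0
      · exact sub_eq_zero.1 (h1 hw)
    have hsdich := forall_eq_or_forall_norm_lt_one hΩ hΩc.isPreconnected (hd (shift φ))
      fun w _ => norm_character_shift_le _
    rcases hZdich with ⟨x, hx1, hx⟩ | hZlt
    · rcases hsdich with ⟨μ, _, hμ⟩ | hslt
      · exact (hconst ((hx w₁ hw₁).trans (hx w₀ hw₀).symm)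
          ((hμ w₁ hw₁).trans (hμ w₀ hw₀).symm)).elim
      · refine ⟨_, Or.inr (Or.inr (Or.inr ⟨x, ⟨hx w₀ hw₀ ▸ hfix w₀ hw₀, by simpa using hx1⟩,
          rfl⟩)), hsub hx fun w hw => by simpa using hslt w hw⟩
    · have hfix0 : ∀ w ∈ Ω, Z w ∈ fixInterior φ := fun w hw =>
        ⟨hfix w hw, by simpa using hZlt w hw⟩
      rcases hsdich with ⟨μ, hμ1, hμ⟩ | hslt
      · refine ⟨_, Or.inr (Or.inr (Or.inl ⟨⟨Z w₁, hfix0 w₁ hw₁, Z w₀, hfix0 w₀ hw₀,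
          fun hZ => hconst hZ ((hμ w₁ hw₁).trans (hμ w₀ hw₀).symm)⟩, μ, hμ1, rfl⟩)),
          hsub hfix0 hμ⟩
      · exact ⟨_, Or.inr (Or.inl ⟨⟨_, hfix0 w₀ hw₀⟩, rfl⟩),
          hsub hfix0 fun w hw => by simpa using hslt w hw⟩

theorem isMaximalAnalyticSet_iff_isListed (hn : 1 ≤ n) (hφ : Isometry φ)
    (O : Set (WeakDual.characterSpace ℂ (SemicrossedProduct φ))) :
    IsMaximalAnalyticSet O ↔ IsListed φ (coords φ '' O) := by
  constructor
  · intro hO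
    obtain ⟨L, hL, hOL⟩ := hO.prop.exists_isListed
    have himg : coords φ '' (coords φ ⁻¹' L) = L := image_preimage_eq_of_subset hL.subset_range
    have han : IsAnalyticSet (coords φ ⁻¹' L) :=
      IsListed.isAnalyticSet hn hφ (by rwa [himg])
    rw [hO.eq_of_subset han (image_subset_iff.1 hOL), himg]
    exact hL
  · intro hL
    refine ⟨hL.isAnalyticSet hn hφ, fun O' hO' hOO' => ?_⟩
    obtain ⟨L', hL', hOL'⟩ := hO'.exists_isListed
    have heq := hL.eq_of_subset hφ hL' ((image_mono hOO').trans hOL')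
    rw [← heq] at hOL'
    exact (image_subset_image_iff coords_injective).1 hOL'

end Listed

end NCSemicrossed

end

theorem lemma3p2 (n : ℕ) (hn : 2 ≤ n)
    (φ : NCSemicrossed.discAlgebra n ≃ₐ[ℂ] NCSemicrossed.discAlgebra n) (hφ : Isometry φ) :
    (Topology.IsEmbedding (NCSemicrossed.coords φ) ∧
      Set.range (NCSemicrossed.coords φ) =
        (Metric.closedBall 0 1 ×ˢ {0}) ∪ (NCSemicrossed.fixSet φ ×ˢ Metric.closedBall 0 1)) ∧
    ∀ O : Set (WeakDual.characterSpace ℂ (NCSemicrossed.SemicrossedProduct φ)),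
      NCSemicrossed.IsMaximalAnalyticSet O ↔
        (φ ≠ AlgEquiv.refl ∧ NCSemicrossed.coords φ '' O = Metric.ball 0 1 ×ˢ {0}) ∨
        ((NCSemicrossed.fixInterior φ).Nonempty ∧
          NCSemicrossed.coords φ '' O = NCSemicrossed.fixInterior φ ×ˢ Metric.ball 0 1) ∨
        ((NCSemicrossed.fixInterior φ).Nontrivial ∧
          ∃ μ : ℂ, ‖μ‖ = 1 ∧ NCSemicrossed.coords φ '' O = NCSemicrossed.fixInterior φ ×ˢ {μ}) ∨
        ∃ x ∈ NCSemicrossed.fixBoundary φ,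
          NCSemicrossed.coords φ '' O = {x} ×ˢ Metric.ball 0 1 :=
  ⟨⟨NCSemicrossed.isEmbedding_coords, NCSemicrossed.range_coords⟩,
    fun O => NCSemicrossed.isMaximalAnalyticSet_iff_isListed (by lia) hφ O⟩
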